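/- Let $F$ be a non-Archimedean local field of characteristic zero and let $\kappa$ be a nontrivial continuous additive character of $F$. For a locally constant sheaf $E$ of complex vector spaces on a space $M$, let $\mathcal S(M,E)$ be the space of compactly supported sections of $E$ and $\mathcal S^*(M,E)$ its linear dual, the space of $E$-distributions ($E=\underline{\mathbb C}$ gives ordinary distributions). *Wave front set.* Let $X$ be an $F$-analytic manifold and $\xi\in\mathcal S^*(X,E)$. We say that $\xi$ is smooth at $(x,v)\in T^*X$ if, in a local analytic chart $\varphi$ at $x$ with values in $F^n$, writing $v=\sum_i w_i\,d_x\varphi_i$, there are open neighbourhoods $A$ of $x$ (inside the domain of $\varphi$) and $B$ of $w$ such that for each $s\in\mathcal S(A,E)$ there is $N>0$ with $\xi\bigl(\kappa(\langle \lambda b,\varphi\rangle)\,s\bigr)=0$ for all $b\in B$ and all $\lambda\in F$ with $|\lambda|>N$. $WF(\xi)\subset T^*X$ is the set of $(x,v)$ at which $\xi$ is not smooth. For a smooth algebraic variety $X$ over $F$, this is applied to the analytic manifold $X(F)$ (with charts given by algebraic local coordinates), and $WF(\xi)\subset T^*X(F)$. The singular support $SS(\xi)\subset T^*X$ is the Zariski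 closure of $WF(\xi)$. Let $p_X:T^*X\to X$ be the projection, and for a subvariety $W \subset X$ and a smooth point $x$ of $W$ let $CN_{W,x}^X\subset T_x^*X$ be the conormal space, i.e. the annihilator of $T_xW$. *Weakly coisotropic.* A subvariety $Z\subset T^*X$ is called weakly coisotropic if for every smooth point $x$ of $p_X(Z)$ the fibre $Z\cap p_X^{-1}(x)$ is locally invariant with respect to shifts by $CN^X_{p_X(Z),x}$, i.e. for every $y\in p_X^{-1}(x)$ the set $(y+CN^X_{p_X(Z),x})\cap Z\cap p_X^{-1}(x)$ is Zariski open in $y+CN^X_{p_X(Z),x}$ (points are taken over an algebraic closure of $F$). **Theorem.** 1. Let $Y\subset X$ be $F$-analytic manifolds ($Y$ an embedded submanifold, $X$ Hausdorff), let $E$ be a locally constant sheaf on $X$, let $\xi\in\mathcal S^*(X,E)$ with $\mathrm{Supp}(\xi)\subset Y$, and let $y\in Y$. Then $WF(\xi)\cap p_X^{-1}(y)$ is invariant with respect to shifts by $CN_{Y,y}^X$. 2. Let $Y\subset X$ be algebraic varieties over $F$, with $X$ smooth, and let $y\in Y(F)$ be a point at which $Y$ is smooth. Let $E$ be a locally constant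 sheaf on $X(F)$ and let $\xi\in\mathcal S^*(X(F),E)$ with $\mathrm{Supp}(\xi)\subset Y(F)$. Then $WF(\xi)\cap p_X^{-1}(y)(F)$ is invariant with respect to shifts by $CN_{Y,y}^X(F)$. 3. Let $X$ be a smooth algebraic variety over $F$, let $E$ be a locally constant sheaf on $X(F)$ and let $\xi\in\mathcal S^*(X(F),E)$. Then $SS(\xi)$ is weakly coisotropic. -/

import Mathlib

open scoped Topology Manifold ContDiff Matrix
open CategoryTheory AlgebraicGeometry

universe u v v' w

noncomputable section

namespace Microlocal

/-! ### Locally constant sheaves and distributions -/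

/-- A locally constant sheaf of complex vector spaces on `M`, given by its stalks and a covering
by trivialisations.  On the open set `nbhd x` the sheaf is identified with the constant sheaf with
fibre `stalk x`, and the transition maps between two such trivialisations are locally constant. -/
structure LocallyConstantSheaf (M : Type v) [TopologicalSpace M] where
  stalk : M → Type w
  [addCommGroup : ∀ x, AddCommGroup (stalk x)]
  [module : ∀ x, Module ℂ (stalk x)]
  nbhd : M → Set M
  isOpen_nbhd : ∀ x, IsOpen (nbhd x)
  mem_nbhd : ∀ x, x ∈ nbhd x
  triv : ∀ x y, y ∈ nbhd x → (stalk y ≃ₗ[ℂ] stalk x)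
  locallyConstant_transition : ∀ (x x' y : M) (h : y ∈ nbhd x) (h' : y ∈ nbhd x') (a : stalk x),
    ∀ᶠ z in 𝓝 y, ∀ (k : z ∈ nbhd x) (k' : z ∈ nbhd x'),
      triv x' z k' ((triv x z k).symm a) = triv x' y h' ((triv x y h).symm a)

attribute [instance] LocallyConstantSheaf.addCommGroup LocallyConstantSheaf.module

namespace LocallyConstantSheaf

variable {M : Type v} [TopologicalSpace M] (E : LocallyConstantSheaf.{v, w} M)

/-- A family of elements of the stalks is a (global) section if it is locally constant in the
trivialisations. -/
def IsSection (s : ∀ x, E.stalk x) : Prop :=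
  ∀ x, ∀ᶠ y in 𝓝 x, ∀ h : y ∈ E.nbhd x, E.triv x y h (s y) = E.triv x x (E.mem_nbhd x) (s x)

/-- The space `𝒮(M, E)` of compactly supported sections of `E`. -/
def schwartz : Submodule ℂ (∀ x, E.stalk x) where
  carrier := {s | E.IsSection s ∧ ∃ C : Set M, IsCompact C ∧ ∀ x ∉ C, s x = 0}
  add_mem' := by
    rintro s t ⟨hs, C, hC, hsC⟩ ⟨ht, D, hD, htD⟩
    refine ⟨fun x => ?_, C ∪ D, hC.union hD, fun x hx => ?_⟩
    · filter_upwards [hs x, ht x] with y h₁ h₂ h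
      simp [h₁ h, h₂ h]
    · rw [Set.mem_union, not_or] at hx
      simp [hsC x hx.1, htD x hx.2]
  zero_mem' := ⟨fun x => by simp, ∅, isCompact_empty, fun x _ => rfl⟩
  smul_mem' := by
    rintro c s ⟨hs, C, hC, hsC⟩
    refine ⟨fun x => ?_, C, hC, fun x hx => ?_⟩
    · filter_upwards [hs x] with y h₁ h
      simp [h₁ h]
    · simp [hsC x hx]

/-- The space `𝒮*(M, E)` of `E`-distributions: all linear functionals on `𝒮(M, E)`. -/
abbrev Distribution : Type _ := E.schwartz →ₗ[ℂ] ℂ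

end LocallyConstantSheaf

open LocallyConstantSheaf

section Local

variable {M : Type v} [TopologicalSpace M] {E : LocallyConstantSheaf.{v, w} M}

/-- The support of a distribution. -/
def support (ξ : E.Distribution) : Set M :=
  {x | ∀ U : Set M, IsOpen U → x ∈ U → ∃ s : E.schwartz, (∀ y ∉ U, s.1 y = 0) ∧ ξ s ≠ 0}

/-- Smoothness of `ξ` at a covector, in a coordinate chart `φ` with values in `Fⁿ`: there are open
neighbourhoods `A` of `x` and `B` of `w` such that for each `s ∈ 𝒮(A, E)` the Fourier transform
`b ↦ ξ (κ⟨b, φ⟩ s)` of the compactly supported distribution `s ξ` vanishes on `c B` for all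
sufficiently large `c ∈ F`.  Here `t` is the section `κ⟨c b, φ⟩ s`. -/
def IsSmoothInChart {F : Type u} [NontriviallyNormedField F] (κ : AddChar F Circle)
    (ξ : E.Distribution) {n : ℕ} (φ : OpenPartialHomeomorph M (Fin n → F))
    (x : M) (w : Fin n → F) : Prop :=
  ∃ A : Set M, IsOpen A ∧ x ∈ A ∧ A ⊆ φ.source ∧
    ∃ B : Set (Fin n → F), IsOpen B ∧ w ∈ B ∧
      ∀ s : E.schwartz, (∀ y ∉ A, s.1 y = 0) →
        ∃ N : ℝ, 0 < N ∧ ∀ c : F, N < ‖c‖ → ∀ b ∈ B, ∀ t : E.schwartz,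
          (∀ y, t.1 y = (κ ((c • b) ⬝ᵥ φ y) : ℂ) • s.1 y) → ξ t = 0

end Local

/-! ### The wave front set on an analytic manifold -/

section Manifold

variable {F : Type u} [NontriviallyNormedField F] {n : ℕ}
  {X : Type v} [TopologicalSpace X] [ChartedSpace (Fin n → F) X]

variable (F n X) in
/-- The cotangent bundle of an analytic manifold modelled on `Fⁿ`, as a set. -/
abbrev AnalyticCotangent : Type _ :=
  Σ x : X, (TangentSpace 𝓘(F, Fin n → F) x →L[F] F)

/-- The wave front set of a distribution on an analytic manifold: `(x, v)` is not in it iff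
in some analytic chart `φ` at `x` the distribution is smooth at the covector with
coordinates `w`, where `v = ∑ wᵢ dφᵢ`. -/
def waveFrontSet (κ : AddChar F Circle) {E : LocallyConstantSheaf.{v, w} X}
    (ξ : E.Distribution) : Set (AnalyticCotangent F n X) :=
  {p | ¬ ∃ φ ∈ IsManifold.maximalAtlas 𝓘(F, Fin n → F) ω X, p.1 ∈ φ.source ∧
    ∃ w : Fin n → F, IsSmoothInChart κ ξ φ p.1 w ∧
      ∀ u : TangentSpace 𝓘(F, Fin n → F) p.1,
        p.2 u = w ⬝ᵥ (show Fin n → F from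
          mfderiv 𝓘(F, Fin n → F) 𝓘(F, Fin n → F) φ p.1 u)}

end Manifold

/-! ### Points, tangent and cotangent spaces of schemes over a field -/

section Scheme

variable {F : Type u} [Field F] {X : Scheme.{u}} (f : X ⟶ Spec (CommRingCat.of F))

/-- The structure map from the base field to the local ring of `X` at `x`. -/
def constGerm (x : X) : F →+* X.presheaf.stalk x :=
  (X.presheaf.germ ⊤ x (TopologicalSpace.Opens.mem_top x)).hom.comp
    (f.appTop.hom.comp (Scheme.ΓSpecIso (CommRingCat.of F)).inv.hom)

variable {f} in
lemma stalkMap_constGerm {Y : Scheme.{u}} (i : Y ⟶ X) (y : Y) (c : F) :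
    (i.stalkMap y).hom (constGerm f (i y) c) = constGerm (i ≫ f) y c := by
  have h := Scheme.Hom.germ_stalkMap i ⊤ y (TopologicalSpace.Opens.mem_top _)
  have h' := congrArg (fun φ => φ.hom (f.appTop.hom
    ((Scheme.ΓSpecIso (CommRingCat.of F)).inv.hom c))) h
  exact h'

/-- The set `X(K)` of `K`-points of the `F`-scheme `X`, i.e. of `F`-morphisms `Spec K ⟶ X`: a
point of `X` together with a local homomorphism of `F`-algebras from its local ring to `K`
(evaluation of germs of functions). -/
structure Point (K : Type u) [Field K] [Algebra F K] where
  pt : X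
  ev : X.presheaf.stalk pt →+* K
  isLocalHom_ev : IsLocalHom ev
  ev_const : ∀ c : F, ev (constGerm f pt c) = algebraMap F K c

variable {f}

namespace Point

variable {K : Type u} [Field K] [Algebra F K] (x : Point f K)

/-- The value at `x` of a regular function on an open set containing `x`. -/
def value (U : X.Opens) (h : x.pt ∈ U) : Γ(X, U) →+* K :=
  x.ev.comp (X.presheaf.germ U x.pt h).hom

/-- The tangent space of `X` at `x ∈ X(K)`: the `F`-derivations `𝒪_{X,x} → K` (over `x.ev`). -/
def tangent : Submodule K (X.presheaf.stalk x.pt → K) where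
  carrier := {D | (∀ a b, D (a + b) = D a + D b) ∧
    (∀ a b, D (a * b) = x.ev a * D b + x.ev b * D a) ∧ ∀ c : F, D (constGerm f x.pt c) = 0}
  add_mem' := by
    rintro D D' ⟨h₁, h₂, h₃⟩ ⟨h₁', h₂', h₃'⟩
    refine ⟨fun a b => ?_, fun a b => ?_, fun c => ?_⟩
    · simp only [Pi.add_apply, h₁, h₁']; ring
    · simp only [Pi.add_apply, h₂, h₂']; ring
    · simp only [Pi.add_apply, h₃, h₃', add_zero]
  zero_mem' := by simp
  smul_mem' := by
    rintro r D ⟨h₁, h₂, h₃⟩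
    refine ⟨fun a b => ?_, fun a b => ?_, fun c => ?_⟩
    · simp only [Pi.smul_apply, smul_eq_mul, h₁]; ring
    · simp only [Pi.smul_apply, smul_eq_mul, h₂]; ring
    · simp only [Pi.smul_apply, smul_eq_mul, h₃, mul_zero]

/-- The cotangent space of `X` at `x ∈ X(K)`. -/
abbrev cotangent : Type u := Module.Dual K x.tangent

/-- The differential at `x` of a germ of a function. -/
def differential (a : X.presheaf.stalk x.pt) : x.cotangent :=
  (LinearMap.proj a).comp x.tangent.subtype

/-- The covector `∑ wᵢ dgᵢ` at `x`. -/
def covector {n : ℕ} (U : X.Opens) (h : x.pt ∈ U) (g : Fin n → Γ(X, U)) (w : Fin n → K) :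
    x.cotangent :=
  ∑ i, w i • x.differential (X.presheaf.germ U x.pt h (g i))

/-- The regular functions `g₁, …, gₙ` are local coordinates at `x`: their differentials form a
basis of the cotangent space. -/
def AreCoordinates {n : ℕ} (U : X.Opens) (h : x.pt ∈ U) (g : Fin n → Γ(X, U)) : Prop :=
  Function.Bijective (x.covector U h g)

/-- The `K`-point defined by an `F`-point. -/
def extend (K : Type u) [Field K] [Algebra F K] (x : Point f F) : Point f K where
  pt := x.pt
  ev := (algebraMap F K).comp x.ev
  isLocalHom_ev := ⟨fun a ha => x.isLocalHom_ev.map_nonunit a (by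
    simpa [isUnit_iff_ne_zero] using ha)⟩
  ev_const c := by simp [x.ev_const]

variable {Y : Scheme.{u}} (i : Y ⟶ X)

/-- The map `Y(K) → X(K)` defined by a morphism `Y ⟶ X` of `F`-schemes. -/
def map (y : Point (i ≫ f) K) : Point f K where
  pt := i y.pt
  ev := y.ev.comp (i.stalkMap y.pt).hom
  isLocalHom_ev := by
    have := y.isLocalHom_ev
    infer_instance
  ev_const c := by
    rw [← y.ev_const c, ← stalkMap_constGerm]
    rfl

/-- The differential `T_y Y → T_{i(y)} X` of a morphism `i : Y ⟶ X`. -/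
def tangentMap (y : Point (i ≫ f) K) : y.tangent →ₗ[K] (y.map i).tangent where
  toFun D := ⟨fun a => D.1 ((i.stalkMap y.pt).hom a), by
    obtain ⟨h₁, h₂, h₃⟩ := D.2
    exact ⟨fun a b => (congrArg D.1 (map_add (i.stalkMap y.pt).hom a b)).trans (h₁ _ _),
      fun a b => (congrArg D.1 (map_mul (i.stalkMap y.pt).hom a b)).trans (h₂ _ _),
      fun c => (congrArg D.1 (stalkMap_constGerm i y.pt c)).trans (h₃ c)⟩⟩
  map_add' _ _ := rfl
  map_smul' _ _ := rfl

/-- The conormal space `CN_{Y,y}^X = (T_y X / T_y Y)^*`, as a subspace of `T_y^* X`. -/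
def conormal (y : Point (i ≫ f) K) : Submodule K (y.map i).cotangent :=
  (LinearMap.range (y.tangentMap i)).dualAnnihilator

/-- The ideal of germs at `x` of functions vanishing on a subset `W ⊆ X(K)` near `x`. -/
def vanishingIdeal (W : Set (Point f K)) : Ideal (X.presheaf.stalk x.pt) :=
  Ideal.span {a | ∃ (U : X.Opens) (h : x.pt ∈ U) (s : Γ(X, U)),
    X.presheaf.germ U x.pt h s = a ∧ ∀ y ∈ W, ∀ hy : y.pt ∈ U, y.value U hy s = 0}

/-- `x` is a smooth point of the subvariety with set of `K`-points `W`: the local ring of this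
(reduced) subvariety at `x` is regular. -/
def IsSmoothPoint (W : Set (Point f K)) : Prop :=
  x ∈ W ∧ IsRegularLocalRing (X.presheaf.stalk x.pt ⧸ x.vanishingIdeal W)

/-- The tangent space at `x` of the subvariety with set of `K`-points `W`. -/
def tangentOf (W : Set (Point f K)) : Submodule K x.tangent where
  carrier := {D | ∀ a ∈ x.vanishingIdeal W, D.1 a = 0}
  add_mem' := by
    intro D D' h h' a ha
    simp [h a ha, h' a ha]
  zero_mem' := by simp
  smul_mem' := by
    intro r D h a ha
    simp [h a ha]

/-- The conormal space at `x` of the subvariety with set of `K`-points `W`. -/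
def conormalOf (W : Set (Point f K)) : Submodule K x.cotangent :=
  (x.tangentOf W).dualAnnihilator

/-- The analytic topology on `X(K)` for a topological field `K`: the coarsest one in which all
`U(K)`, `U ⊆ X` open, are open and all regular functions on `U` are continuous on `U(K)`. -/
instance [TopologicalSpace K] : TopologicalSpace (Point f K) :=
  TopologicalSpace.generateFrom
    {S | ∃ (U : X.Opens) (s : Γ(X, U)) (O : Set K), IsOpen O ∧
      S = {x | ∃ h : x.pt ∈ U, x.value U h s ∈ O}}

end Point

variable (f) in
/-- The set `T^*X(K)` of `K`-points of the cotangent bundle. -/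
abbrev Cotangent (K : Type u) [Field K] [Algebra F K] : Type u := Σ x : Point f K, x.cotangent

/-- The image in `T^*X(K)` of a set of `F`-points of `T^*X`. -/
def extendCotangent (K : Type u) [Field K] [Algebra F K] (S : Set (Cotangent f F)) :
    Set (Cotangent f K) :=
  {q | ∃ p ∈ S, ∃ v' : (p.1.extend K).cotangent,
    (∀ (D : p.1.tangent) (D' : (p.1.extend K).tangent),
      (∀ a, D'.1 a = algebraMap F K (D.1 a)) → v' D' = algebraMap F K (p.2 D)) ∧
    q = ⟨p.1.extend K, v'⟩}

/-! ### Zariski closure and weakly coisotropic subvarieties -/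

section Zariski

variable {K : Type u} [Field K] [Algebra F K]

/-- Coordinates `g₁, …, gₙ` on an open set `U` identify `T^*U` with `U × 𝔸ⁿ`, so
that regular functions on `T^*U` (`U` affine) are polynomials in `n` variables with coefficients
in `Γ(X, U)`.  This says that such a function vanishes at `q`, or that `q` is not over `U`. -/
def VanishesAt {n : ℕ} (U : X.Opens) (g : Fin n → Γ(X, U)) (P : MvPolynomial (Fin n) Γ(X, U))
    (q : Cotangent f K) : Prop :=
  ∀ (h : q.1.pt ∈ U) (a : Fin n → K), q.1.covector U h g a = q.2 →
    P.eval₂ (q.1.value U h) a = 0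

/-- The Zariski closure of a subset of `T^*X(K)` (`K` an algebraically closed extension of `F`)
among subvarieties defined over `F`: over each affine open `U ⊆ X` with
coordinates it is the set of common zeros of all regular functions on `T^*U` that vanish on the
part of `S` over `U`. -/
def zariskiClosure (S : Set (Cotangent f K)) : Set (Cotangent f K) :=
  {q | ∀ (U : X.Opens), IsAffineOpen U → ∀ (n : ℕ) (g : Fin n → Γ(X, U)),
    (∀ (x : Point f K) (h : x.pt ∈ U), x.AreCoordinates U h g) →
    ∀ P : MvPolynomial (Fin n) Γ(X, U), (∀ p ∈ S, VanishesAt U g P p) → VanishesAt U g P q}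

/-- Zariski open subsets of a `K`-vector space: complements of common zero sets of polynomials in
linear functionals. -/
def IsZariskiOpen {V : Type u} [AddCommGroup V] [Module K V] (O : Set V) : Prop :=
  ∃ J : Set (MvPolynomial (Module.Dual K V) K),
    O = {v | ∃ P ∈ J, MvPolynomial.eval (fun l : Module.Dual K V => l v) P ≠ 0}

/-- The subvariety of `T^*X` with set of `K`-points `Z` (`K` algebraically closed) is weakly
coisotropic: with `W = p_X(Z)`, for each smooth point `x` of `W` the fibre of `Z` over `x` is locally
invariant with respect to shifts by `CN_{W,x}^X`, i.e. for each `y ∈ T_x^*X` the intersection of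
`y + CN_{W,x}^X` with this fibre is Zariski open in `y + CN_{W,x}^X`. -/
def IsWeaklyCoisotropic (Z : Set (Cotangent f K)) : Prop :=
  ∀ x : Point f K, x.IsSmoothPoint (Sigma.fst '' Z) → ∀ y : x.cotangent,
    IsZariskiOpen (K := K)
      {c : x.conormalOf (Sigma.fst '' Z) | (⟨x, y + c.1⟩ : Cotangent f K) ∈ Z}

end Zariski

end Scheme

/-! ### Wave front set and singular support on an algebraic variety -/

section Algebraic

variable {F : Type u} [NontriviallyNormedField F] {X : Scheme.{u}}
  {f : X ⟶ Spec (CommRingCat.of F)}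

/-- The chart `e` of `X(F)` is given by regular functions `g₁, …, gₙ` on `U` that are local
coordinates at all points of its domain. -/
def IsAlgebraicChart {n : ℕ} (e : OpenPartialHomeomorph (Point f F) (Fin n → F)) (U : X.Opens)
    (g : Fin n → Γ(X, U)) : Prop :=
  ∀ x ∈ e.source, ∃ h : x.pt ∈ U, (∀ i, e x i = x.value U h (g i)) ∧ x.AreCoordinates U h g

/-- The wave front set of a distribution on the analytic manifold `X(F)`, `X` a smooth algebraic
variety, computed in charts given by algebraic local coordinates (these form an analytic atlas of
`X(F)`): `(x, v)` is not in it iff in some chart `e = (g₁, …, gₙ)` at `x` the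
distribution is smooth at the covector with coordinates `w`, where `v = ∑ wᵢ dgᵢ`. -/
def algWaveFrontSet (κ : AddChar F Circle) {E : LocallyConstantSheaf.{u, w} (Point f F)}
    (ξ : E.Distribution) : Set (Cotangent f F) :=
  {p | ¬ ∃ (n : ℕ) (e : OpenPartialHomeomorph (Point f F) (Fin n → F)) (U : X.Opens)
    (g : Fin n → Γ(X, U)), IsAlgebraicChart e U g ∧ p.1 ∈ e.source ∧
      ∃ (h : p.1.pt ∈ U) (w : Fin n → F),
        IsSmoothInChart κ ξ e p.1 w ∧ p.2 = p.1.covector U h g w}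

/-- The singular support of `ξ`: the Zariski closure of its wave front set in `T^*X`, as a set of
points over an algebraic closure of `F`. -/
def singularSupport (κ : AddChar F Circle) {E : LocallyConstantSheaf.{u, w} (Point f F)}
    (ξ : E.Distribution) : Set (Cotangent f (AlgebraicClosure F)) :=
  zariskiClosure (extendCotangent (AlgebraicClosure F) (algWaveFrontSet κ ξ))

end Algebraic

end Microlocal

end

/-!
The proof rests on one principle: if a function `h` vanishes on the support of `ξ`, then shifts by
its differential preserve the wave front set. A distribution does not see sections vanishing on its
support (`apply_eq_zero_of_support`), hence it does not distinguish a chart `φ` from the chart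
`ψ = φ - h u`, `u ∈ Fⁿ`. If `ξ` is smooth in `φ` at the covector with coordinates `w`, it is therefore
smooth in `ψ` at the covector with the same coordinates (`IsSmoothInChart.congr_chart`), which is
`w · dφ - (w · u) dh`. With `w · u = 1` this is the shift by `-dh`, and `ψ` is a chart as soon as
`a · u ≠ 1`, where `dh = a · dφ`. Such a `u` exists unless `w = 0` or `w = a`.

In these exceptional cases `w` is conormal to the support, and smoothness at `w` forces `ξ` to
vanish near the point (`IsSmoothInChart.vanishesNear`), so that `ξ` is smooth at every covector
there. Indeed, for large `c` the distribution kills `κ (c (w + b) · φ) s` for all `b` in a small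
ball; the average of the characters `κ (c b · φ)` over the ball is the indicator function of a
small set, and on its intersection with the support `κ (c w · φ)` is constant. So `ξ` kills the
restrictions of `s` to such sets, which suffices by compactness.

On manifolds, a conormal covector of an embedded submanifold is the differential of a function that
is linear in an immersion chart and vanishes on the submanifold (`exists_eq_zero_on_range`).

On algebraic varieties, conormal covectors are linear combinations of differentials of regular
functions in the ideal of the subvariety (`mem_span_of_mem_conormal`). To run the principle in
algebraic charts one needs that regular functions are strictly differentiable there. By Nakayama's
lemma the differences `1 ⊗ gᵢ - gᵢ ⊗ 1` of coordinates generate the ideal of the diagonal near a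
diagonal point (`exists_mul_sub_eq_sum`), and this expresses difference quotients of regular
functions by continuous functions.

For the singular support, let `s` vanish on its projection `W`. The support of `ξ` is contained in
`W`, because the wave front set contains the zero covectors over the support. So the wave front set
is invariant under the shifts by `r ds` with `r ∈ F`, and even with regular functions `r`; since
`F` is infinite, the Zariski closure is invariant under these shifts with `r` in the algebraic
closure (`zariskiClosure_add_smul_differential`). The conormal space of `W` at a point is spanned
by such `ds`, so the intersection of a fibre of the singular support with `y + CN` is empty or all
of `y + CN`.
-/

namespace Microlocal

open LocallyConstantSheaf

/-! ### Sections of a locally constant sheaf -/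

section Sections

variable {M : Type v} [TopologicalSpace M] {E : LocallyConstantSheaf.{v, w} M}

lemma eventually_eq_zero_iff {s : ∀ x, E.stalk x} (hs : E.IsSection s) (x : M) :
    ∀ᶠ y in 𝓝 x, (s y = 0 ↔ s x = 0) := by
  filter_upwards [hs x, (E.isOpen_nbhd x).mem_nhds (E.mem_nbhd x)] with y h hy
  rw [← (E.triv x y hy).map_eq_zero_iff, h hy, LinearEquiv.map_eq_zero_iff]

lemma isClopen_ne_zero (s : E.schwartz) : IsClopen {x | s.1 x ≠ 0} := by
  constructor
  · rw [← isOpen_compl_iff, isOpen_iff_mem_nhds]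
    intro x hx
    filter_upwards [eventually_eq_zero_iff s.2.1 x] with y hy
    simpa [hy] using hx
  · rw [isOpen_iff_mem_nhds]
    intro x hx
    filter_upwards [eventually_eq_zero_iff s.2.1 x] with y hy
    simpa [hy] using hx

lemma isCompact_ne_zero (s : E.schwartz) : IsCompact {x | s.1 x ≠ 0} := by
  obtain ⟨C, hC, hs⟩ := s.2.2
  refine hC.of_isClosed_subset (isClopen_ne_zero s).1 fun x hx => ?_
  by_contra h
  exact hx (hs x h)

/-- The product `θ s` of a section with a function that is locally constant where `s ≠ 0`. -/
noncomputable def mulSection (θ : M → ℂ) (s : E.schwartz)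
    (hθ : ∀ x, s.1 x ≠ 0 → ∀ᶠ y in 𝓝 x, θ y = θ x) : E.schwartz :=
  ⟨fun x => θ x • s.1 x, fun x => by
    by_cases hx : s.1 x = 0
    · filter_upwards [eventually_eq_zero_iff s.2.1 x] with y h k
      simp [h.2 hx, hx]
    · filter_upwards [s.2.1 x, hθ x hx] with y h h' k
      simp [h k, h'],
    s.2.2.imp fun C hC => ⟨hC.1, fun x hx => by simp [hC.2 x hx]⟩⟩

lemma exists_section_indicator (s : E.schwartz) {Q : Set M} (hQ : IsClopen Q) :
    ∃ t : E.schwartz, ∀ y, t.1 y = Q.indicator (1 : M → ℂ) y • s.1 y := by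
  refine ⟨mulSection (Q.indicator 1) s fun x _ => ?_, fun y => rfl⟩
  by_cases hx : x ∈ Q
  · filter_upwards [hQ.2.mem_nhds hx] with y hy
    rw [Set.indicator_of_mem hy, Set.indicator_of_mem hx]
    rfl
  · filter_upwards [hQ.compl.2.mem_nhds hx] with y hy
    rw [Set.indicator_of_notMem hy, Set.indicator_of_notMem hx]

/-- A distribution kills `s` if it kills the restrictions of `s` to all small members of an algebra
of clopen sets. -/
lemma apply_eq_zero_of_local (ξ : E.Distribution) (s : E.schwartz) (𝒬 : Set M → Prop)
    (hcl : ∀ Q, 𝒬 Q → IsClopen Q) (hinter : ∀ Q Q', 𝒬 Q → 𝒬 Q' → 𝒬 (Q ∩ Q'))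
    (hdiff : ∀ Q Q', 𝒬 Q → 𝒬 Q' → 𝒬 (Q \ Q')) (hunion : ∀ Q Q', 𝒬 Q → 𝒬 Q' → 𝒬 (Q ∪ Q'))
    (hs : 𝒬 {x | s.1 x ≠ 0})
    (hloc : ∀ x, s.1 x ≠ 0 → ∃ Q, 𝒬 Q ∧ x ∈ Q ∧ ∀ Q' ⊆ Q, 𝒬 Q' → ∀ t : E.schwartz,
      (∀ y, t.1 y = Q'.indicator (1 : M → ℂ) y • s.1 y) → ξ t = 0) : ξ s = 0 := by
  suffices h : ∃ Q, 𝒬 Q ∧ {x | s.1 x ≠ 0} ⊆ Q ∧ ∀ Q' ⊆ Q, 𝒬 Q' → ∀ t : E.schwartz,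
      (∀ y, t.1 y = Q'.indicator (1 : M → ℂ) y • s.1 y) → ξ t = 0 by
    obtain ⟨Q, -, hQ, h⟩ := h
    refine h _ hQ hs s fun y => ?_
    by_cases hy : s.1 y = 0 <;> simp [hy]
  refine (isCompact_ne_zero s).induction_on
    (p := fun T => ∃ Q, 𝒬 Q ∧ T ⊆ Q ∧ ∀ Q' ⊆ Q, 𝒬 Q' → ∀ t : E.schwartz,
      (∀ y, t.1 y = Q'.indicator (1 : M → ℂ) y • s.1 y) → ξ t = 0) ?_ ?_ ?_ ?_
  · refine ⟨∅, by simpa using hdiff _ _ hs hs, subset_rfl, fun Q' hQ' _ t ht => ?_⟩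
    obtain rfl := Set.subset_empty_iff.1 hQ'
    have : t = 0 := Subtype.ext (funext fun y => by simp [ht y])
    rw [this, map_zero]
  · rintro T T' h ⟨Q, hQ, hT, hQ'⟩
    exact ⟨Q, hQ, h.trans hT, hQ'⟩
  · rintro T T' ⟨Q, hQ, hT, h⟩ ⟨R, hR, hT', h'⟩
    refine ⟨Q ∪ R, hunion _ _ hQ hR, Set.union_subset_union hT hT', fun Q' hQ' hq t ht => ?_⟩
    obtain ⟨t₁, ht₁⟩ := exists_section_indicator s (hcl _ (hinter _ _ hq hQ))
    obtain ⟨t₂, ht₂⟩ := exists_section_indicator s (hcl _ (hdiff _ _ hq hQ))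
    have e : t = t₁ + t₂ := by
      refine Subtype.ext (funext fun y => ?_)
      change t.1 y = t₁.1 y + t₂.1 y
      rw [ht, ht₁, ht₂, ← add_smul]
      congr 1
      by_cases h1 : y ∈ Q' <;> by_cases h2 : y ∈ Q <;> simp [h1, h2]
    rw [e, map_add, h _ Set.inter_subset_right (hinter _ _ hq hQ) _ ht₁,
      h' _ (fun x hx => (hQ' hx.1).resolve_left hx.2) (hdiff _ _ hq hQ) _ ht₂, add_zero]
  · intro x hx
    obtain ⟨Q, hQ, hxQ, h⟩ := hloc x hx
    exact ⟨Q, mem_nhdsWithin_of_mem_nhds ((hcl _ hQ).2.mem_nhds hxQ), Q, hQ, subset_rfl, h⟩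

end Sections

section Chart

variable {F : Type u} [NontriviallyNormedField F] {n : ℕ}
  {M : Type v} [TopologicalSpace M] {E : LocallyConstantSheaf.{v, w} M}

lemma isClopen_inter_preimage (φ : OpenPartialHomeomorph M (Fin n → F)) {D : Set M}
    (hD : IsClopen D) (hDφ : D ⊆ φ.source) {V : Set (Fin n → F)} (hV : IsClopen V) :
    IsClopen (D ∩ φ ⁻¹' V) :=
  ⟨(φ.continuousOn.mono hDφ).preimage_isClosed_of_isClosed hD.1 hV.1,
    (φ.continuousOn.mono hDφ).isOpen_inter_preimage hD.2 hV.2⟩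

/-- Clopen neighbourhoods inside a clopen set contained in a chart domain form a basis; no
separation axiom on `M` is needed. -/
lemma exists_isClopen_subset [IsUltrametricDist F] (φ : OpenPartialHomeomorph M (Fin n → F))
    {D : Set M} (hD : IsClopen D) (hDφ : D ⊆ φ.source) {x : M} (hx : x ∈ D) {U : Set M}
    (hU : U ∈ 𝓝 x) : ∃ Q, IsClopen Q ∧ x ∈ Q ∧ Q ⊆ U := by
  have h : φ.symm ⁻¹' U ∈ 𝓝 (φ x) := by
    apply (φ.continuousAt_symm (φ.map_source (hDφ hx))).preimage_mem_nhds
    rwa [φ.left_inv (hDφ hx)]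
  obtain ⟨r, hr, hrU⟩ := Metric.mem_nhds_iff.1 h
  refine ⟨D ∩ φ ⁻¹' Metric.ball (φ x) r,
    isClopen_inter_preimage φ hD hDφ (IsUltrametricDist.isClopen_ball _ _),
    ⟨hx, Metric.mem_ball_self hr⟩, fun y hy => ?_⟩
  have := hrU hy.2
  rwa [Set.mem_preimage, φ.left_inv (hDφ hy.1)] at this

/-- A section vanishing on a closed set vanishes near it, so a distribution does not see sections
that vanish on its support. -/
lemma apply_eq_zero_of_support [IsUltrametricDist F] (φ : OpenPartialHomeomorph M (Fin n → F))
    (ξ : E.Distribution) (s : E.schwartz) (hsφ : ∀ y ∉ φ.source, s.1 y = 0)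
    (hs : ∀ x ∈ support ξ, s.1 x = 0) : ξ s = 0 := by
  refine apply_eq_zero_of_local ξ s IsClopen (fun _ => id) (fun _ _ => IsClopen.inter)
    (fun _ _ => IsClopen.diff) (fun _ _ => IsClopen.union) (isClopen_ne_zero s) fun x hx => ?_
  have hx' : x ∉ support ξ := fun h => hx (hs x h)
  simp only [support, Set.mem_ofPred_eq, not_forall, not_exists, not_and, not_not] at hx'
  obtain ⟨U, hU, hxU, h⟩ := hx'
  obtain ⟨Q, hQ, hxQ, hQU⟩ := exists_isClopen_subset φ (isClopen_ne_zero s)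
    (fun y hy => by_contra fun h' => hy (hsφ y h')) hx (hU.mem_nhds hxU)
  refine ⟨Q, hQ, hxQ, fun Q' hQ' _ t ht => h t fun y hy => ?_⟩
  rw [ht, Set.indicator_of_notMem fun h' => hy (hQU (hQ' h')), zero_smul]

end Chart

/-! ### Additive characters of a local field -/

section Characters

/-- The circle has no small subgroups: if `z ^ 2 ^ k` stays near `1`, its distance from `1` grows at
each squaring by the factor `‖z ^ 2 ^ k + 1‖ ≥ 3 / 2`. -/
lemma eq_one_of_forall_norm_pow_sub_one_le {z : ℂ} (h : ∀ k : ℕ, ‖z ^ k - 1‖ ≤ 1 / 2) : z = 1 := by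
  have key : ∀ k : ℕ, (3 / 2 : ℝ) ^ k * ‖z - 1‖ ≤ ‖z ^ 2 ^ k - 1‖ := by
    intro k
    induction k with
    | zero => simp
    | succ k ih =>
      set a := z ^ 2 ^ k with ha
      have e : z ^ 2 ^ (k + 1) - 1 = (a + 1) * (a - 1) := by rw [ha, pow_succ, pow_mul]; ring
      have h1 : (3 / 2 : ℝ) ≤ ‖a + 1‖ := by
        have h2 : ‖(2 : ℂ)‖ ≤ ‖a + 1‖ + ‖a - 1‖ := by
          have := norm_sub_le (a + 1) (a - 1)
          rwa [show a + 1 - (a - 1) = 2 by ring] at this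
        have h3 := h (2 ^ k)
        rw [← ha] at h3
        norm_num at h2
        linarith
      rw [e, norm_mul, pow_succ, mul_comm _ (3 / 2 : ℝ), mul_assoc]
      gcongr
  by_contra hz
  have hpos : 0 < ‖z - 1‖ := norm_pos_iff.2 (sub_ne_zero.2 hz)
  obtain ⟨k, hk⟩ := pow_unbounded_of_one_lt (1 / ‖z - 1‖) (by norm_num : (1 : ℝ) < 3 / 2)
  rw [div_lt_iff₀ hpos] at hk
  linarith [key k, h (2 ^ k)]

variable {F : Type u} [NontriviallyNormedField F] [IsUltrametricDist F]

lemma norm_nsmul_le_of_isUltrametricDist (k : ℕ) (a : F) : ‖k • a‖ ≤ ‖a‖ := by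
  induction k with
  | zero => simp
  | succ k ih =>
    rw [succ_nsmul]
    exact (IsUltrametricDist.norm_add_le_max _ _).trans (max_le ih le_rfl)

/-- A continuous character is trivial near `0`: the circle has no small subgroups. -/
lemma exists_forall_norm_le_eq_one {κ : AddChar F Circle} (hκ : Continuous κ) :
    ∃ η > 0, ∀ a : F, ‖a‖ ≤ η → κ a = 1 := by
  have hc : Continuous fun a : F => (κ a : ℂ) := continuous_subtype_val.comp hκ
  obtain ⟨r, hr, h⟩ := Metric.continuousAt_iff.1 (hc.continuousAt (x := 0)) (1 / 2) (by norm_num)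
  refine ⟨r / 2, by positivity, fun a ha => ?_⟩
  refine Circle.coe_injective ?_
  rw [Circle.coe_one]
  refine eq_one_of_forall_norm_pow_sub_one_le fun k => ?_
  have := @h (k • a) (by
    rw [dist_zero_right]
    linarith [norm_nsmul_le_of_isUltrametricDist k a])
  rw [dist_eq_norm, AddChar.map_nsmul_eq_pow] at this
  simpa using this.le

lemma norm_dotProduct_le {n : ℕ} (a b : Fin n → F) : ‖a ⬝ᵥ b‖ ≤ ‖a‖ * ‖b‖ := by
  refine IsUltrametricDist.norm_sum_le_of_forall_le_of_nonneg (by positivity) fun i _ => ?_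
  rw [norm_mul]
  gcongr <;> exact norm_le_pi_norm _ i

omit [IsUltrametricDist F] in
/-- If the character `b ↦ κ (c b · z)` is trivial on a ball, then `z` is small. -/
lemma norm_le_of_forall_eq_one {n : ℕ} {κ : AddChar F Circle} {a₀ : F} (ha₀ : κ a₀ ≠ 1)
    {c d : F} {z : Fin n → F} (h : ∀ b : Fin n → F, ‖b‖ ≤ ‖d‖ → κ ((c • b) ⬝ᵥ z) = 1) :
    ‖c‖ * ‖d‖ * ‖z‖ ≤ ‖a₀‖ := by
  have key : ∀ i, ‖c‖ * ‖d‖ * ‖z i‖ ≤ ‖a₀‖ := by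
    intro i
    by_contra! hi
    have hcz : c * z i ≠ 0 := by
      intro h0
      rcases mul_eq_zero.1 h0 with h0 | h0 <;> rw [h0] at hi <;> simp at hi <;>
        exact (norm_nonneg _).not_gt hi
    refine ha₀ ?_
    rw [← h (Pi.single i (a₀ / (c * z i)))]
    · congr 1
      rw [smul_dotProduct, single_dotProduct, smul_eq_mul]
      field_simp [left_ne_zero_of_mul hcz, right_ne_zero_of_mul hcz]
    · rw [Pi.norm_single, norm_div, div_le_iff₀ (norm_pos_iff.2 hcz), norm_mul]
      linarith
  rw [← norm_mul, ← norm_smul, pi_norm_le_iff_of_nonneg (norm_nonneg _)]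
  intro i
  rw [Pi.smul_apply, norm_smul, norm_mul]
  exact key i

/-- Orthogonality of characters for a finite quotient `G ⧸ U`, in terms of representatives. -/
lemma exists_finset_sum_addChar {G : Type*} [AddCommGroup G] (U : AddSubgroup G)
    [Finite (G ⧸ U)] : ∃ T : Finset G, T.Nonempty ∧ ∀ χ : AddChar G Circle, (∀ u ∈ U, χ u = 1) →
      ((∀ g, χ g = 1) → ∑ b ∈ T, (χ b : ℂ) = T.card) ∧
      ((¬ ∀ g, χ g = 1) → ∑ b ∈ T, (χ b : ℂ) = 0) := by
  classical
  have := Fintype.ofFinite (G ⧸ U)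
  have hinj : Function.Injective (Quotient.out : G ⧸ U → G) := fun a b h => by
    rw [← Quotient.out_eq a, h, Quotient.out_eq]
  refine ⟨Finset.univ.map ⟨Quotient.out, hinj⟩, by
    rw [Finset.map_nonempty]; exact ⟨((0 : G) : G ⧸ U), Finset.mem_univ _⟩,
    fun χ hχ => ⟨fun h => by simp [h], ?_⟩⟩
  intro h
  push Not at h
  obtain ⟨g, hg⟩ := h
  rw [Finset.sum_map]
  have hmk : ∀ a b : G, (a : G ⧸ U) = b → χ a = χ b := by
    intro a b hab
    have := hχ _ (QuotientAddGroup.eq.1 hab)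
    rw [AddChar.map_add_eq_mul, AddChar.map_neg_eq_inv, inv_mul_eq_one] at this
    exact this
  have hout : ∀ q : G ⧸ U, ((Quotient.out q : G) : G ⧸ U) = q := fun q => Quotient.out_eq q
  have e : ∑ q : G ⧸ U, (χ (Quotient.out q) : ℂ)
      = (χ g : ℂ) * ∑ q : G ⧸ U, (χ (Quotient.out q) : ℂ) := by
    rw [Finset.mul_sum, ← Equiv.sum_comp (Equiv.addLeft (g : G ⧸ U))]
    refine Finset.sum_congr rfl fun q _ => ?_
    rw [← Circle.coe_mul, ← AddChar.map_add_eq_mul]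
    congr 1
    refine hmk _ _ ?_
    rw [hout, QuotientAddGroup.mk_add, hout]
    rfl
  have hg' : (χ g : ℂ) ≠ 1 := fun h' => hg (Circle.coe_injective (h'.trans Circle.coe_one.symm))
  by_contra h0
  exact hg' (mul_right_cancel₀ h0 (by rw [one_mul]; exact e.symm))

/-- The closed ball of radius `r` about `0`, as a group. -/
def ballSubgroup (V : Type*) [SeminormedAddCommGroup V] [IsUltrametricDist V] (r : ℝ) (hr : 0 ≤ r) :
    AddSubgroup V where
  carrier := {b | ‖b‖ ≤ r}
  add_mem' ha hb := (IsUltrametricDist.norm_add_le_max _ _).trans (max_le ha hb)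
  zero_mem' := by simpa using hr
  neg_mem' := by simp

/-- On bounded sets of `z`, the average of finitely many of the characters `z ↦ κ (c b · z)`, `b` in
a fixed ball, is the indicator function of the common kernel of all of them. -/
lemma exists_finset_sum_character [ProperSpace F] {n : ℕ} {κ : AddChar F Circle}
    (hκ : Continuous κ) (c : F) {r : ℝ} (hr : 0 ≤ r) (R : ℝ) :
    ∃ T : Finset (Fin n → F), T.Nonempty ∧ (∀ b ∈ T, ‖b‖ ≤ r) ∧ ∀ z : Fin n → F, ‖z‖ ≤ R →
      ((∀ b : Fin n → F, ‖b‖ ≤ r → κ ((c • b) ⬝ᵥ z) = 1) →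
        ∑ b ∈ T, (κ ((c • b) ⬝ᵥ z) : ℂ) = T.card) ∧
      ((¬ ∀ b : Fin n → F, ‖b‖ ≤ r → κ ((c • b) ⬝ᵥ z) = 1) →
        ∑ b ∈ T, (κ ((c • b) ⬝ᵥ z) : ℂ) = 0) := by
  obtain ⟨η, hη, hκη⟩ := exists_forall_norm_le_eq_one hκ
  set L := ballSubgroup (Fin n → F) r hr
  set r' : ℝ := η / (‖c‖ * |R| + 1) with hr'
  have hr'pos : 0 < r' := by positivity
  let U : AddSubgroup L := (ballSubgroup (Fin n → F) r' hr'pos.le).addSubgroupOf L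
  have : CompactSpace L := isCompact_iff_compactSpace.1 (by
    have e : (L : Set (Fin n → F)) = Metric.closedBall 0 r := by
      ext b
      rw [mem_closedBall_zero_iff]
      rfl
    rw [e]
    exact isCompact_closedBall 0 r)
  have hU : IsOpen (U : Set L) := by
    refine AddSubgroup.isOpen_of_mem_nhds U (g := 0) ?_
    refine Filter.mem_of_superset (Metric.closedBall_mem_nhds (0 : L) hr'pos) fun b hb => ?_
    rw [mem_closedBall_zero_iff] at hb
    exact hb
  have : Finite (L ⧸ U) := U.quotient_finite_of_isOpen hU
  obtain ⟨T, hT, hχ⟩ := exists_finset_sum_addChar U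
  refine ⟨T.map (Function.Embedding.subtype _), by simpa using hT, fun b hb => ?_, fun z hz => ?_⟩
  · obtain ⟨b', -, rfl⟩ := Finset.mem_map.1 hb
    exact b'.2
  · let χ : AddChar L Circle :=
      { toFun := fun b => κ ((c • b.1) ⬝ᵥ z)
        map_zero_eq_one' := by simp
        map_add_eq_mul' := fun a b => by
          rw [← AddChar.map_add_eq_mul, ← add_dotProduct, ← smul_add]; rfl }
    have h := hχ χ fun b hb => hκη _ <| by
      have hb' : ‖b.1‖ ≤ r' := hb
      refine (norm_dotProduct_le _ _).trans ?_
      rw [norm_smul]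
      calc ‖c‖ * ‖b.1‖ * ‖z‖ ≤ ‖c‖ * r' * |R| := by gcongr; exact hz.trans (le_abs_self R)
        _ = η * ((‖c‖ * |R|) / (‖c‖ * |R| + 1)) := by rw [hr']; ring
        _ ≤ η * 1 := by
          gcongr
          rw [div_le_one (by positivity)]
          linarith
        _ = η := mul_one η
    have hiff : (∀ g, χ g = 1) ↔ ∀ b : Fin n → F, ‖b‖ ≤ r → κ ((c • b) ⬝ᵥ z) = 1 :=
      ⟨fun h b hb => h ⟨b, hb⟩, fun h b => h b.1 b.2⟩
    rw [← hiff, Finset.sum_map, Finset.card_map]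
    exact h

end Characters

/-! ### Smoothness at a covector and the support -/

section SmoothCovectors

variable {F : Type u} [NontriviallyNormedField F] [IsUltrametricDist F] {n : ℕ}
  {M : Type v} [TopologicalSpace M] {E : LocallyConstantSheaf.{v, w} M} {κ : AddChar F Circle}

/-- `ξ` vanishes on an open neighbourhood of `x`. -/
def VanishesNear (ξ : E.Distribution) (x : M) : Prop :=
  ∃ A : Set M, IsOpen A ∧ x ∈ A ∧ ∀ s : E.schwartz, (∀ y ∉ A, s.1 y = 0) → ξ s = 0

omit [IsUltrametricDist F] in
lemma VanishesNear.isSmoothInChart {ξ : E.Distribution} {x : M} (h : VanishesNear ξ x)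
    {φ : OpenPartialHomeomorph M (Fin n → F)} (hx : x ∈ φ.source) (w : Fin n → F) :
    IsSmoothInChart κ ξ φ x w := by
  obtain ⟨A, hA, hxA, h⟩ := h
  refine ⟨A ∩ φ.source, hA.inter φ.open_source, ⟨hxA, hx⟩, Set.inter_subset_right, Set.univ,
    isOpen_univ, Set.mem_univ _, fun s hs => ⟨1, one_pos, fun c _ b _ t ht => h t fun y hy => ?_⟩⟩
  rw [ht, hs y fun h => hy h.1, smul_zero]

lemma VanishesNear.notMem_support {ξ : E.Distribution} {x : M} (h : VanishesNear ξ x) :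
    x ∉ support ξ := by
  obtain ⟨A, hA, hxA, h⟩ := h
  intro hx
  obtain ⟨s, hs, hs'⟩ := hx A hA hxA
  exact hs' (h s hs)

/-- The character `κ ∘ g` is locally constant where `g` is continuous. -/
lemma eventually_character_eq (hκ : Continuous κ) {g : M → F} {x : M} (hg : ContinuousAt g x) :
    ∀ᶠ y in 𝓝 x, (κ (g y) : ℂ) = κ (g x) := by
  obtain ⟨η, hη, h⟩ := exists_forall_norm_le_eq_one hκ
  filter_upwards [Metric.continuousAt_iff'.1 hg η hη] with y hy
  have := h (g y - g x) (by rw [← dist_eq_norm]; exact hy.le)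
  rw [AddChar.map_sub_eq_div, div_eq_one] at this
  rw [this]

/-- The modulated section `κ⟨b, φ - z⟩ s`. -/
noncomputable def modulate (hκ : Continuous κ) (φ : OpenPartialHomeomorph M (Fin n → F))
    (b z : Fin n → F) (s : E.schwartz) (hs : ∀ y ∉ φ.source, s.1 y = 0) : E.schwartz :=
  mulSection (fun y => (κ (b ⬝ᵥ (φ y - z)) : ℂ)) s fun x hx => by
    refine eventually_character_eq (g := fun y => b ⬝ᵥ (φ y - z)) hκ ?_
    have h : ContinuousAt φ x := φ.continuousAt (by_contra fun h => hx (hs x h))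
    simp only [dotProduct, Pi.sub_apply]
    exact tendsto_finsetSum _ fun i _ => tendsto_const_nhds.mul
      (((continuous_apply i).continuousAt.comp h).sub tendsto_const_nhds)

/-- Two charts that agree on the support of `ξ` near `x` have the same smooth covectors, in
coordinates. -/
lemma IsSmoothInChart.congr_chart (hκ : Continuous κ) {ξ : E.Distribution}
    {φ ψ : OpenPartialHomeomorph M (Fin n → F)} {x : M} {w : Fin n → F} (hx : x ∈ ψ.source)
    (h : IsSmoothInChart κ ξ φ x w) (hφψ : ∀ᶠ y in 𝓝 x, y ∈ support ξ → ψ y = φ y) :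
    IsSmoothInChart κ ξ ψ x w := by
  obtain ⟨A, hA, hxA, hAφ, B, hB, hwB, h⟩ := h
  obtain ⟨O, hO, hOo, hxO⟩ := eventually_nhds_iff.1 hφψ
  refine ⟨A ∩ ψ.source ∩ O, (hA.inter ψ.open_source).inter hOo, ⟨⟨hxA, hx⟩, hxO⟩,
    fun y hy => hy.1.2, B, hB, hwB, fun s hs => ?_⟩
  have hsA : ∀ y ∉ A, s.1 y = 0 := fun y hy => hs y fun h => hy h.1.1
  have hsφ : ∀ y ∉ φ.source, s.1 y = 0 := fun y hy => hsA y fun h => hy (hAφ h)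
  obtain ⟨N, hN, h⟩ := h s hsA
  refine ⟨N, hN, fun c hc b hb t ht => ?_⟩
  have ht' : ∀ y, (modulate hκ φ (c • b) 0 s hsφ).1 y = (κ ((c • b) ⬝ᵥ φ y) : ℂ) • s.1 y :=
    fun y => by simp [modulate, mulSection]
  have h0 := h c hc b hb _ ht'
  refine Eq.trans (sub_eq_zero.1 ?_) h0
  rw [← map_sub]
  refine apply_eq_zero_of_support φ ξ _ (fun y hy => ?_) fun y hy => ?_
  · change t.1 y - (modulate hκ φ (c • b) 0 s hsφ).1 y = 0
    rw [ht, ht', hsφ y hy, smul_zero, smul_zero, sub_zero]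
  · change t.1 y - (modulate hκ φ (c • b) 0 s hsφ).1 y = 0
    by_cases hyO : y ∈ O
    · rw [ht, ht', hO y hyO hy, sub_self]
    · rw [ht, ht', hs y fun h => hyO h.2, smul_zero, smul_zero, sub_zero]

/-- A distribution that is smooth at `(x, w)`, `w` conormal to the support at `x`, vanishes near
`x`.  Averaging the characters `κ (c b · φ)` over `b` in a ball about `w` gives the indicator
functions of small pieces of the support, `κ (c w · φ)` being constant on each of them. -/
lemma IsSmoothInChart.vanishesNear [ProperSpace F] (hκ : Continuous κ) (hκ_ne : κ ≠ 1)
    {ξ : E.Distribution} {φ : OpenPartialHomeomorph M (Fin n → F)} {x : M} {w : Fin n → F}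
    (h : IsSmoothInChart κ ξ φ x w)
    (hw : ∀ ε > 0, ∃ O ∈ 𝓝 x, ∀ y ∈ O, ∀ z ∈ O, y ∈ support ξ → z ∈ support ξ →
      ‖w ⬝ᵥ (φ y - φ z)‖ ≤ ε * ‖φ y - φ z‖) : VanishesNear ξ x := by
  obtain ⟨A, hA, hxA, hAφ, B, hB, hwB, h⟩ := h
  obtain ⟨η, hη, hκη⟩ := exists_forall_norm_le_eq_one hκ
  obtain ⟨a₀, ha₀⟩ := AddChar.ne_one_iff.1 hκ_ne
  have ha₀' : 0 < ‖a₀‖ := norm_pos_iff.2 fun h0 => ha₀ (by rw [h0, AddChar.map_zero_eq_one])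
  obtain ⟨r, hr, hrB⟩ := Metric.isOpen_iff.1 hB w hwB
  obtain ⟨d, hd0, hdr⟩ := NormedField.exists_norm_lt F hr
  obtain ⟨O, hO, hwO⟩ := hw (η * ‖d‖ / ‖a₀‖) (by positivity)
  obtain ⟨O', hO', hO'o, hxO'⟩ := mem_nhds_iff.1 hO
  refine ⟨A ∩ O', hA.inter hO'o, ⟨hxA, hxO'⟩, fun s hs => ?_⟩
  have hsA : ∀ y ∉ A, s.1 y = 0 := fun y hy => hs y fun h => hy h.1
  have hsφ : ∀ y ∉ φ.source, s.1 y = 0 := fun y hy => hsA y fun h => hy (hAφ h)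
  have hDφ : {y | s.1 y ≠ 0} ⊆ φ.source := fun y hy => by_contra fun h => hy (hsφ y h)
  obtain ⟨N, hN, h⟩ := h s hsA
  obtain ⟨c, hc⟩ := NormedField.exists_lt_norm F N
  have hc0 : 0 < ‖c‖ := hN.trans hc
  -- Points are equivalent if no character `κ (c b · φ)`, `‖b‖ ≤ ‖d‖`, separates them.
  set P : (Fin n → F) → Prop := fun z => ∀ b : Fin n → F, ‖b‖ ≤ ‖d‖ → κ ((c • b) ⬝ᵥ z) = 1 with hP
  have hPsub : ∀ {p q}, P p → P q → P (p - q) := fun {p q} hp hq b hb => by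
    rw [dotProduct_sub, AddChar.map_sub_eq_div, hp b hb, hq b hb, div_one]
  have hP0 : P 0 := fun b hb => by simp
  have hPnear : ∀ᶠ z in 𝓝 (0 : Fin n → F), P z := by
    filter_upwards [Metric.closedBall_mem_nhds (0 : Fin n → F)
      (show 0 < η / (‖c‖ * ‖d‖) by positivity)] with z hz b hb
    rw [mem_closedBall_zero_iff] at hz
    refine hκη _ ((norm_dotProduct_le _ _).trans ?_)
    rw [norm_smul]
    calc ‖c‖ * ‖b‖ * ‖z‖ ≤ ‖c‖ * ‖d‖ * (η / (‖c‖ * ‖d‖)) := by gcongr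
      _ = η := by field_simp
  have hPcl : ∀ p, IsClopen {z | P (z - p)} := by
    have hopen : ∀ p, IsOpen {z | P (z - p)} := by
      intro p
      rw [isOpen_iff_mem_nhds]
      intro z hz
      have : Filter.Tendsto (fun z' => z - z') (𝓝 z) (𝓝 (0 : Fin n → F)) := by
        have := (continuous_const.sub continuous_id : Continuous fun z' : Fin n → F => z - z')
        exact sub_self z ▸ this.tendsto z
      filter_upwards [this.eventually hPnear] with z' hz'
      have := hPsub hz hz'
      simpa using this
    refine fun p => ⟨?_, hopen p⟩
    rw [← isOpen_compl_iff, isOpen_iff_mem_nhds]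
    intro z hz
    filter_upwards [(hopen z).mem_nhds (by simpa using hP0)] with z' hz' hz''
    refine hz ?_
    have := hPsub hz'' hz'
    simpa using this
  -- The sets saturated for this relation; those inside a class are empty or the whole class.
  refine apply_eq_zero_of_local ξ s (fun Q => IsClopen Q ∧ Q ⊆ {y | s.1 y ≠ 0} ∧
      ∀ y z, y ∈ Q → s.1 z ≠ 0 → P (φ z - φ y) → z ∈ Q) (fun _ h => h.1)
    (fun Q Q' h h' => ⟨h.1.inter h'.1, fun y hy => h.2.1 hy.1,
      fun y z hy hz hp => ⟨h.2.2 y z hy.1 hz hp, h'.2.2 y z hy.2 hz hp⟩⟩)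
    (fun Q Q' h h' => ⟨h.1.diff h'.1, fun y hy => h.2.1 hy.1,
      fun y z hy hz hp => ⟨h.2.2 y z hy.1 hz hp, fun hz' => hy.2 (h'.2.2 z y hz' (h.2.1 hy.1)
        (by simpa using hPsub hP0 hp))⟩⟩)
    (fun Q Q' h h' => ⟨h.1.union h'.1, Set.union_subset h.2.1 h'.2.1,
      fun y z hy hz hp => hy.imp (fun hy => h.2.2 y z hy hz hp) (fun hy => h'.2.2 y z hy hz hp)⟩)
    ⟨isClopen_ne_zero s, subset_rfl, fun _ _ _ hz _ => hz⟩ fun x₁ hx₁ => ?_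
  refine ⟨{y | s.1 y ≠ 0} ∩ φ ⁻¹' {z | P (z - φ x₁)},
    ⟨isClopen_inter_preimage φ (isClopen_ne_zero s) hDφ (hPcl _), Set.inter_subset_left, ?_⟩,
    ⟨hx₁, by simpa using hP0⟩, fun Q' hQ' hQ t ht => ?_⟩
  · rintro y z ⟨hy, hy'⟩ hz hp
    refine ⟨hz, ?_⟩
    have := hPsub hp (hPsub hP0 hy')
    simpa using this
  by_cases hQs : ∃ x₀ ∈ Q', x₀ ∈ support ξ
  swap
  · refine apply_eq_zero_of_support φ ξ t (fun y hy => by rw [ht, hsφ y hy, smul_zero])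
      fun y hy => ?_
    rw [ht, Set.indicator_of_notMem fun h' => hQs ⟨y, h', hy⟩, zero_smul]
  obtain ⟨x₀, hx₀, hx₀s⟩ := hQs
  have hmem : ∀ y, s.1 y ≠ 0 → (y ∈ Q' ↔ P (φ y - φ x₀)) := by
    refine fun y hy => ⟨fun hyQ => ?_, fun hp => hQ.2.2 x₀ y hx₀ hy hp⟩
    have := hPsub (hQ' hyQ).2 (hQ' hx₀).2
    simpa using this
  -- On the support of `ξ`, the section `t` is the average of the modulated sections
  -- `κ (c (w + b) · (φ - φ x₀)) s`, which `ξ` kills.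
  obtain ⟨R, hR⟩ := ((isCompact_ne_zero s).image_of_continuousOn
    (φ.continuousOn.mono hDφ)).isBounded.exists_norm_le
  obtain ⟨T, hT, hTd, hTsum⟩ := exists_finset_sum_character (n := n) hκ c (norm_nonneg d)
    (R + ‖φ x₀‖)
  have hzero : ∀ b ∈ T, ξ (modulate hκ φ (c • (w + b)) (φ x₀) s hsφ) = 0 := by
    intro b hb
    have h0 := h c hc (w + b) (hrB (by simpa using (hTd b hb).trans_lt hdr))
      (modulate hκ φ (c • (w + b)) 0 s hsφ) fun y => by simp [modulate, mulSection]
    have e : modulate hκ φ (c • (w + b)) (φ x₀) s hsφ = (κ (-((c • (w + b)) ⬝ᵥ φ x₀)) : ℂ) •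
        modulate hκ φ (c • (w + b)) 0 s hsφ := by
      refine Subtype.ext (funext fun y => ?_)
      change (κ ((c • (w + b)) ⬝ᵥ (φ y - φ x₀)) : ℂ) • s.1 y = (κ (-((c • (w + b)) ⬝ᵥ φ x₀)) : ℂ) •
        ((κ ((c • (w + b)) ⬝ᵥ (φ y - 0)) : ℂ) • s.1 y)
      rw [smul_smul, ← Circle.coe_mul, ← AddChar.map_add_eq_mul, dotProduct_sub, sub_zero,
        neg_add_eq_sub]
    rw [e, map_smul, h0, smul_zero]
  set t' : E.schwartz := (T.card : ℂ)⁻¹ • ∑ b ∈ T, modulate hκ φ (c • (w + b)) (φ x₀) s hsφ with ht'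
  have hξt' : ξ t' = 0 := by
    rw [ht', map_smul, map_sum, Finset.sum_eq_zero hzero, smul_zero]
  have ht'y : ∀ y, t'.1 y = ((T.card : ℂ)⁻¹ * ∑ b ∈ T,
      (κ ((c • (w + b)) ⬝ᵥ (φ y - φ x₀)) : ℂ)) • s.1 y := by
    intro y
    rw [ht', mul_smul, Finset.sum_smul]
    simp [modulate, mulSection]
  refine Eq.trans (sub_eq_zero.1 ?_) hξt'
  rw [← map_sub]
  refine apply_eq_zero_of_support φ ξ _ (fun y hy => ?_) fun y hy => ?_
  · change t.1 y - t'.1 y = 0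
    rw [ht, ht'y, hsφ y hy, smul_zero, smul_zero, sub_zero]
  change t.1 y - t'.1 y = 0
  by_cases hsy : s.1 y = 0
  · rw [ht, ht'y, hsy, smul_zero, smul_zero, sub_zero]
  rw [sub_eq_zero, ht, ht'y]
  congr 1
  have hsplit : ∀ b, (κ ((c • (w + b)) ⬝ᵥ (φ y - φ x₀)) : ℂ) =
      κ ((c • w) ⬝ᵥ (φ y - φ x₀)) * κ ((c • b) ⬝ᵥ (φ y - φ x₀)) := fun b => by
    rw [smul_add, add_dotProduct, AddChar.map_add_eq_mul, Circle.coe_mul]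
  simp_rw [hsplit]
  rw [← Finset.mul_sum]
  have hbound : ‖φ y - φ x₀‖ ≤ R + ‖φ x₀‖ :=
    (norm_sub_le _ _).trans (by gcongr; exact hR _ ⟨y, hsy, rfl⟩)
  by_cases hp : P (φ y - φ x₀)
  · have hx₀0 : s.1 x₀ ≠ 0 := hQ.2.1 hx₀
    have hyO : y ∈ O := hO' (by_contra fun h' => hsy (hs y fun h'' => h' h''.2))
    have hx₀O : x₀ ∈ O := hO' (by_contra fun h' => hx₀0 (hs x₀ fun h'' => h' h''.2))
    have hw1 : κ ((c • w) ⬝ᵥ (φ y - φ x₀)) = 1 := by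
      refine hκη _ ?_
      rw [smul_dotProduct, norm_smul]
      have h1 := hwO y hyO x₀ hx₀O hy hx₀s
      have h2 := norm_le_of_forall_eq_one ha₀ hp
      calc ‖c‖ * ‖w ⬝ᵥ (φ y - φ x₀)‖ ≤ ‖c‖ * (η * ‖d‖ / ‖a₀‖ * ‖φ y - φ x₀‖) := by gcongr
        _ = η / ‖a₀‖ * (‖c‖ * ‖d‖ * ‖φ y - φ x₀‖) := by ring
        _ ≤ η / ‖a₀‖ * ‖a₀‖ := by gcongr
        _ = η := by field_simp
    rw [Set.indicator_of_mem ((hmem y hsy).2 hp), (hTsum _ hbound).1 hp, hw1, Circle.coe_one,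
      one_mul, inv_mul_cancel₀ (by simpa using hT.ne_empty), Pi.one_apply]
  · rw [Set.indicator_of_notMem fun h' => hp ((hmem y hsy).1 h'), (hTsum _ hbound).2 hp, mul_zero,
      mul_zero]

end SmoothCovectors

/-! ### Modifying a chart along its conormal directions -/

section Shear

variable {F : Type u} [NontriviallyNormedField F] {n : ℕ}

/-- The linear form `z ↦ a · z` on `Fⁿ`. -/
noncomputable def dotCLM (a : Fin n → F) : (Fin n → F) →L[F] F :=
  ∑ i, a i • ContinuousLinearMap.proj i

@[simp]
lemma dotCLM_apply (a z : Fin n → F) : dotCLM a z = a ⬝ᵥ z := by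
  simp [dotCLM, dotProduct]

lemma dotCLM_single (L : (Fin n → F) →L[F] F) : dotCLM (fun i => L (Pi.single i 1)) = L := by
  ext z
  rw [dotCLM_apply, ← ContinuousLinearMap.coe_coe L, LinearMap.pi_apply_eq_sum_univ _ z]
  refine Finset.sum_congr rfl fun i _ => ?_
  have e : (Pi.single i 1 : Fin n → F) = fun j => if i = j then 1 else 0 := by
    ext j
    simp [Pi.single_apply, eq_comm]
  rw [smul_eq_mul, mul_comm, ← e]

/-- The linear map `z ↦ z - (a · z) u` is invertible if `a · u ≠ 1`. -/
noncomputable def shearEquiv (a u : Fin n → F) (h : a ⬝ᵥ u ≠ 1) :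
    (Fin n → F) ≃L[F] (Fin n → F) :=
  ContinuousLinearEquiv.equivOfInverse
    (ContinuousLinearMap.id F _ - (dotCLM a).smulRight u)
    (ContinuousLinearMap.id F _ + (dotCLM ((1 - a ⬝ᵥ u)⁻¹ • a)).smulRight u)
    (fun z => by
      have h' : 1 - a ⬝ᵥ u ≠ 0 := sub_ne_zero.2 h.symm
      ext i
      simp
      field_simp
      ring)
    (fun z => by
      have h' : 1 - a ⬝ᵥ u ≠ 0 := sub_ne_zero.2 h.symm
      ext i
      simp
      field_simp
      ring)

@[simp]
lemma shearEquiv_apply (a u : Fin n → F) (h : a ⬝ᵥ u ≠ 1) (z : Fin n → F) :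
    shearEquiv a u h z = z - (a ⬝ᵥ z) • u := by
  simp [shearEquiv]

lemma hasStrictFDerivAt_shear {k : (Fin n → F) → F} {p a : Fin n → F}
    (hk : HasStrictFDerivAt k (dotCLM a) p) (u : Fin n → F) (h : a ⬝ᵥ u ≠ 1) :
    HasStrictFDerivAt (fun z => z - k z • u)
      (shearEquiv a u h : (Fin n → F) →L[F] (Fin n → F)) p := by
  exact (hasStrictFDerivAt_id p).sub (hk.smul_const u)

end Shear

section Dichotomy

variable {F : Type u} [NontriviallyNormedField F] [IsUltrametricDist F] [ProperSpace F] {n : ℕ}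
  {M : Type v} [TopologicalSpace M] {E : LocallyConstantSheaf.{v, w} M} {κ : AddChar F Circle}

omit [IsUltrametricDist F] [ProperSpace F] in
lemma exists_dotProduct_eq_one {w a : Fin n → F} (hw : w ≠ 0) (hwa : w ≠ a) :
    ∃ u : Fin n → F, w ⬝ᵥ u = 1 ∧ a ⬝ᵥ u ≠ 1 := by
  obtain ⟨i, hi⟩ := Function.ne_iff.1 hw
  have hu₀ : w ⬝ᵥ Pi.single i (w i)⁻¹ = 1 := by
    rw [dotProduct_single, mul_inv_cancel₀ hi]
  by_cases h : a ⬝ᵥ Pi.single i (w i)⁻¹ = 1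
  · obtain ⟨j, hj⟩ := Function.ne_iff.1 hwa
    refine ⟨Pi.single i (w i)⁻¹ + (Pi.single j 1 - w j • Pi.single i (w i)⁻¹), ?_, ?_⟩
    · simp [hu₀]
    · simp only [dotProduct_add, dotProduct_sub, dotProduct_smul, h, dotProduct_single]
      intro h'
      refine hj ?_
      simp only [mul_one, smul_eq_mul] at h'
      linear_combination -h'
  · exact ⟨_, hu₀, h⟩

/-- Let `h` vanish on the support of `ξ`, with differential `a` at `x` in the chart `φ`.  If `ξ` is
smooth at `w`, then `ξ` vanishes near `x` or there is `u` such that `φ - h u` is again a chart at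
`x` (this is `a · u ≠ 1`), in which the coordinates `w` represent the covector shifted by `-a`
(this is `w · u = 1`).  Only `w = 0` and `w = a` exclude such a `u`, and both are conormal to the
support. -/
lemma IsSmoothInChart.vanishesNear_or_exists (hκ : Continuous κ) (hκ_ne : κ ≠ 1)
    {ξ : E.Distribution} {φ : OpenPartialHomeomorph M (Fin n → F)} {x : M} (hx : x ∈ φ.source)
    {w : Fin n → F} (hs : IsSmoothInChart κ ξ φ x w) {h : M → F}
    (h0 : ∀ᶠ y in 𝓝 x, y ∈ support ξ → h y = 0) {a : Fin n → F}
    (ha : HasStrictFDerivAt (h ∘ φ.symm) (dotCLM a) (φ x)) :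
    VanishesNear ξ x ∨ ∃ u, w ⬝ᵥ u = 1 ∧ a ⬝ᵥ u ≠ 1 := by
  by_cases hw : w = 0
  · refine Or.inl (hs.vanishesNear hκ hκ_ne fun ε hε => ⟨Set.univ, Filter.univ_mem, ?_⟩)
    intro y _ z _ _ _
    rw [hw, zero_dotProduct, norm_zero]
    positivity
  by_cases hwa : w = a
  · refine Or.inl (hs.vanishesNear hκ hκ_ne fun ε hε => ?_)
    obtain ⟨V, hV, hVε⟩ := Filter.eventually_prod_self_iff'.1
      (nhds_prod_eq (x := φ x) (y := φ x) ▸ (ha.isLittleO.def hε))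
    refine ⟨{y | y ∈ support ξ → h y = 0} ∩ φ ⁻¹' V ∩ φ.source, Filter.inter_mem
      (Filter.inter_mem h0 ((φ.continuousAt hx).preimage_mem_nhds hV))
      (φ.open_source.mem_nhds hx), ?_⟩
    rintro y ⟨⟨hy, hyV⟩, hyφ⟩ z ⟨⟨hz, hzV⟩, hzφ⟩ hys hzs
    have := hVε _ hyV _ hzV
    simpa [φ.left_inv hyφ, φ.left_inv hzφ, hy hys, hz hzs, ← hwa, dotProduct_sub,
      norm_sub_rev (w ⬝ᵥ φ z)] using this
  · exact Or.inr (exists_dotProduct_eq_one hw hwa)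

end Dichotomy

/-! ### Analytic manifolds -/

section Analytic

variable {F : Type u} [NontriviallyNormedField F] {n : ℕ}
  {X : Type v} [TopologicalSpace X] [ChartedSpace (Fin n → F) X]

lemma trans_mem_maximalAtlas [IsManifold 𝓘(F, Fin n → F) ω X]
    {φ : OpenPartialHomeomorph X (Fin n → F)}
    (hφ : φ ∈ IsManifold.maximalAtlas 𝓘(F, Fin n → F) ω X)
    {Ψ : OpenPartialHomeomorph (Fin n → F) (Fin n → F)}
    (hΨ : Ψ ∈ contDiffGroupoid ω 𝓘(F, Fin n → F)) :
    φ.trans Ψ ∈ IsManifold.maximalAtlas 𝓘(F, Fin n → F) ω X := by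
  intro e' he'
  have he'' := IsManifold.subset_maximalAtlas (I := 𝓘(F, Fin n → F)) (n := ω) he'
  constructor
  · rw [OpenPartialHomeomorph.trans_symm_eq_symm_trans_symm, OpenPartialHomeomorph.trans_assoc]
    exact (contDiffGroupoid _ _).trans ((contDiffGroupoid _ _).symm hΨ)
      (StructureGroupoid.compatible_of_mem_maximalAtlas hφ he'')
  · rw [← OpenPartialHomeomorph.trans_assoc]
    exact (contDiffGroupoid _ _).trans
      (StructureGroupoid.compatible_of_mem_maximalAtlas he'' hφ) hΨ

/-- The analytic inverse function theorem, as an element of the groupoid of analytic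
diffeomorphisms. -/
lemma exists_mem_contDiffGroupoid [CompleteSpace F] {Φ : (Fin n → F) → Fin n → F} {p : Fin n → F}
    (hΦ : ContDiffAt F ω Φ p) {L : (Fin n → F) ≃L[F] (Fin n → F)}
    (hL : HasStrictFDerivAt Φ (L : (Fin n → F) →L[F] (Fin n → F)) p) :
    ∃ Ψ ∈ contDiffGroupoid ω 𝓘(F, Fin n → F), p ∈ Ψ.source ∧ ∀ z, Ψ z = Φ z := by
  set Ψ₀ := hL.toOpenPartialHomeomorph Φ with hΨ₀
  have hp : p ∈ Ψ₀.source := hL.mem_toOpenPartialHomeomorph_source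
  have hcoe : ∀ z, Ψ₀ z = Φ z := fun z => rfl
  have hsymm : ContDiffAt F ω Ψ₀.symm (Ψ₀ p) :=
    Ψ₀.contDiffAt_symm (Ψ₀.map_source hp) (f₀' := L)
      (by rw [Ψ₀.left_inv hp]; exact hL.hasFDerivAt) (by rw [Ψ₀.left_inv hp]; exact hΦ)
  obtain ⟨O₁, hO₁, hO₁o, hpO₁⟩ := eventually_nhds_iff.1 (hΦ.eventually (by simp))
  obtain ⟨O₂, hO₂, hO₂o, hpO₂⟩ := eventually_nhds_iff.1 (hsymm.eventually (by simp))
  have hopen : IsOpen (O₁ ∩ (Ψ₀.source ∩ Ψ₀ ⁻¹' O₂)) :=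
    hO₁o.inter (Ψ₀.isOpen_inter_preimage hO₂o)
  refine ⟨Ψ₀.restrOpen _ hopen, ?_, ⟨hp, hpO₁, hp, hpO₂⟩, hcoe⟩
  rw [contDiffGroupoid, mem_groupoid_of_pregroupoid]
  constructor
  · rintro z ⟨hz, -⟩
    exact (hO₁ z hz.2.1).contDiffWithinAt
  · rintro z ⟨hz, -⟩
    have hz1 : z ∈ Ψ₀.target := hz.1
    have hz2 : Ψ₀.symm z ∈ O₁ ∩ (Ψ₀.source ∩ Ψ₀ ⁻¹' O₂) := hz.2
    have hz3 : Ψ₀ (Ψ₀.symm z) ∈ O₂ := hz2.2.2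
    rw [Ψ₀.right_inv hz1] at hz3
    exact (hO₂ z hz3).contDiffWithinAt

variable [IsUltrametricDist F] [ProperSpace F] [IsManifold 𝓘(F, Fin n → F) ω X]
  {κ : AddChar F Circle}

/-- The wave front set at `p` is invariant under the differential of any analytic function that
vanishes on the support of the distribution. -/
theorem waveFrontSet_add_of_eq_zero_on_support (hκ : Continuous κ) (hκ_ne : κ ≠ 1)
    {E : LocallyConstantSheaf.{v, w} X} {ξ : E.Distribution} {p : X} {h : X → F}
    (h0 : ∀ᶠ y in 𝓝 p, y ∈ support ξ → h y = 0)
    (hh : ContMDiffAt 𝓘(F, Fin n → F) 𝓘(F, F) ω h p)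
    {v c : TangentSpace 𝓘(F, Fin n → F) p →L[F] F}
    (hc : HasMFDerivAt 𝓘(F, Fin n → F) 𝓘(F, F) h p c)
    (hv : (⟨p, v⟩ : AnalyticCotangent F n X) ∈ waveFrontSet κ ξ) :
    (⟨p, v + c⟩ : AnalyticCotangent F n X) ∈ waveFrontSet κ ξ := by
  rintro ⟨φ, hφ, hpφ, w, hs, hw⟩
  refine hv ?_
  have hφ1 : φ ∈ IsManifold.maximalAtlas 𝓘(F, Fin n → F) 1 X :=
    IsManifold.maximalAtlas_subset_of_le le_top hφ
  have hDφ := (mdifferentiableAt_of_mem_maximalAtlas hφ1 hpφ).hasMFDerivAt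
  set k := h ∘ φ.symm with hk_def
  have hk : ContDiffAt F ω k (φ p) := by
    rw [← contMDiffAt_iff_contDiffAt]
    refine ContMDiffAt.comp (φ p) (I' := 𝓘(F, Fin n → F)) ?_
      (contMDiffAt_symm_of_mem_maximalAtlas hφ (φ.map_source hpφ))
    rwa [φ.left_inv hpφ]
  set a : Fin n → F := fun i => fderiv F k (φ p) (Pi.single i 1) with ha_def
  have ha : HasStrictFDerivAt k (dotCLM a) (φ p) := by
    rw [ha_def, dotCLM_single]
    exact hk.analyticAt.hasStrictFDerivAt
  have hca : ∀ t : TangentSpace 𝓘(F, Fin n → F) p, c t = a ⬝ᵥ (show Fin n → F from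
      mfderiv 𝓘(F, Fin n → F) 𝓘(F, Fin n → F) φ p t) := by
    have h1 : HasMFDerivAt 𝓘(F, Fin n → F) 𝓘(F, F) h p ((dotCLM a).comp
        (mfderiv 𝓘(F, Fin n → F) 𝓘(F, Fin n → F) φ p)) := by
      refine (HasMFDerivAt.comp p ha.hasFDerivAt.hasMFDerivAt hDφ).congr_of_eventuallyEq ?_
      filter_upwards [φ.open_source.mem_nhds hpφ] with y hy
      simp [k, φ.left_inv hy]
    intro t
    rw [hasMFDerivAt_unique hc h1, ← dotCLM_apply]
    rfl
  rcases hs.vanishesNear_or_exists hκ hκ_ne hpφ h0 ha with hvan | ⟨u, hwu, hau⟩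
  · refine ⟨φ, hφ, hpφ, w - a, hvan.isSmoothInChart hpφ _, fun t => ?_⟩
    rw [sub_dotProduct, ← hw t, ← hca t]
    exact (add_sub_cancel_right (v t) (c t)).symm
  · have hΦ := hasStrictFDerivAt_shear ha u hau
    obtain ⟨Ψ, hΨ, hpΨ, hΨcoe⟩ := exists_mem_contDiffGroupoid
      (contDiffAt_id.sub (hk.smul contDiffAt_const)) hΦ
    have hpψ : p ∈ (φ.trans Ψ).source := by
      rw [OpenPartialHomeomorph.trans_source]
      exact ⟨hpφ, hpΨ⟩
    refine ⟨φ.trans Ψ, trans_mem_maximalAtlas hφ hΨ, hpψ, w, hs.congr_chart hκ hpψ ?_, fun t => ?_⟩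
    · filter_upwards [h0, φ.open_source.mem_nhds hpφ] with y hy hyφ hys
      rw [OpenPartialHomeomorph.coe_trans, Function.comp_apply, hΨcoe]
      simp [k, φ.left_inv hyφ, hy hys]
    · have hD : HasMFDerivAt 𝓘(F, Fin n → F) 𝓘(F, Fin n → F) (φ.trans Ψ) p
          ((shearEquiv a u hau : (Fin n → F) →L[F] (Fin n → F)).comp
            (mfderiv 𝓘(F, Fin n → F) 𝓘(F, Fin n → F) φ p)) := by
        have : (φ.trans Ψ : X → Fin n → F) = (fun z => z - k z • u) ∘ φ := by
          ext1 y
          rw [OpenPartialHomeomorph.coe_trans, Function.comp_apply, hΨcoe]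
          rfl
        rw [this]
        exact HasMFDerivAt.comp p hΦ.hasFDerivAt.hasMFDerivAt hDφ
      rw [hD.mfderiv]
      change v t = w ⬝ᵥ shearEquiv a u hau (show Fin n → F from
        mfderiv 𝓘(F, Fin n → F) 𝓘(F, Fin n → F) φ p t)
      rw [shearEquiv_apply, dotProduct_sub, dotProduct_smul, hwu, ← hca t, ← hw t]
      change v t = v t + c t - c t • 1
      simp

omit [IsUltrametricDist F] [ProperSpace F] [IsManifold 𝓘(F, Fin n → F) ω X] in
/-- A conormal covector of an embedded submanifold is the differential of an analytic function
vanishing on the submanifold. -/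
lemma exists_eq_zero_on_range {k : ℕ} {Y : Type v'} [TopologicalSpace Y]
    [ChartedSpace (Fin k → F) Y] [IsManifold 𝓘(F, Fin k → F) ω Y] {i : Y → X}
    (hi : Manifold.IsSmoothEmbedding 𝓘(F, Fin k → F) 𝓘(F, Fin n → F) ω i) (y : Y)
    {c : TangentSpace 𝓘(F, Fin n → F) (i y) →L[F] F}
    (hc : c.comp (mfderiv 𝓘(F, Fin k → F) 𝓘(F, Fin n → F) i y) = 0) :
    ∃ h : X → F, (∀ᶠ x in 𝓝 (i y), x ∈ Set.range i → h x = 0) ∧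
      ContMDiffAt 𝓘(F, Fin n → F) 𝓘(F, F) ω h (i y) ∧
      HasMFDerivAt 𝓘(F, Fin n → F) 𝓘(F, F) h (i y) c := by
  have him := hi.isImmersion.isImmersionAt y
  set d := him.domChart
  set e := him.codChart
  have hyd : y ∈ d.source := him.mem_domChart_source
  have hye : i y ∈ e.source := him.mem_codChart_source
  have hd : d ∈ IsManifold.maximalAtlas 𝓘(F, Fin k → F) 1 Y :=
    IsManifold.maximalAtlas_subset_of_le le_top him.domChart_mem_maximalAtlas
  have he : e ∈ IsManifold.maximalAtlas 𝓘(F, Fin n → F) 1 X :=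
    IsManifold.maximalAtlas_subset_of_le le_top him.codChart_mem_maximalAtlas
  have hed : e.MDifferentiable 𝓘(F, Fin n → F) 𝓘(F, Fin n → F) :=
    ⟨fun x hx => (mdifferentiableAt_of_mem_maximalAtlas he hx).mdifferentiableWithinAt,
      fun x hx => (mdifferentiableAt_symm_of_mem_maximalAtlas he hx).mdifferentiableWithinAt⟩
  have hdd : d.MDifferentiable 𝓘(F, Fin k → F) 𝓘(F, Fin k → F) :=
    ⟨fun x hx => (mdifferentiableAt_of_mem_maximalAtlas hd hx).mdifferentiableWithinAt,
      fun x hx => (mdifferentiableAt_symm_of_mem_maximalAtlas hd hx).mdifferentiableWithinAt⟩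
  have hDi := (him.contMDiffAt.mdifferentiableAt (by simp)).hasMFDerivAt
  let ℓ : (Fin n → F) →L[F] F := c.comp
    (mfderiv 𝓘(F, Fin n → F) 𝓘(F, Fin n → F) e.symm (e (i y)))
  have hℓ : HasMFDerivAt 𝓘(F, Fin n → F) 𝓘(F, F) (fun x => ℓ (e x - e (i y))) (i y) c := by
    have h1 : HasFDerivAt (fun z => ℓ (z - e (i y))) ℓ (e (i y)) :=
      ℓ.hasFDerivAt.comp _ ((hasFDerivAt_id _).sub_const _)
    have h2 := HasMFDerivAt.comp (i y) h1.hasMFDerivAt (hed.mdifferentiableAt hye).hasMFDerivAt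
    have h3 : c = ℓ.comp (mfderiv 𝓘(F, Fin n → F) 𝓘(F, Fin n → F) e (i y)) := by
      ext t
      exact congrArg c (DFunLike.congr_fun (hed.symm_comp_deriv hye) t).symm
    rw [h3]
    exact h2
  -- The linear function in the immersion chart `e` with differential `c`.
  refine ⟨fun x => ℓ (e x - e (i y)), ?_, ?_, hℓ⟩
  · let Λ : (Fin k → F) →L[F] (Fin n → F) :=
      (him.equiv : ((Fin k → F) × him.complement) →L[F] (Fin n → F)).comp
        (ContinuousLinearMap.inl F _ _)
    have hΛ : ∀ y' ∈ d.source, e (i y') = Λ (d y') := by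
      intro y' hy'
      have := him.writtenInCharts (show d y' ∈ (d.extend 𝓘(F, Fin k → F)).target by
        rw [OpenPartialHomeomorph.extend_target]
        simpa using d.map_source hy')
      have h1 : e (i (d.symm (d y'))) = him.equiv (d y', 0) := by simpa using this
      rw [d.left_inv hy'] at h1
      exact h1
    -- In the charts `d` and `e` the linear map `ℓ ∘ Λ` is the differential of `h ∘ i`.
    have hℓΛ : ℓ.comp Λ = 0 := by
      have h1 := HasMFDerivAt.comp y hℓ hDi
      have h2 : HasMFDerivAt 𝓘(F, Fin k → F) 𝓘(F, F) (fun y' => ℓ (Λ (d y') - e (i y))) y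
          ((ℓ.comp Λ).comp (mfderiv 𝓘(F, Fin k → F) 𝓘(F, Fin k → F) d y)) := by
        have h3 : HasFDerivAt (fun z => ℓ (Λ z - e (i y))) (ℓ.comp Λ) (d y) :=
          ℓ.hasFDerivAt.comp _ (Λ.hasFDerivAt.sub_const _)
        exact HasMFDerivAt.comp (g := fun z => ℓ (Λ z - e (i y))) y h3.hasMFDerivAt
          (hdd.mdifferentiableAt hyd).hasMFDerivAt
      have h4 := hasMFDerivAt_unique h1 (h2.congr_of_eventuallyEq (by
        filter_upwards [d.open_source.mem_nhds hyd] with y' hy'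
        simp [hΛ y' hy']))
      have h5 := hc.symm.trans h4
      ext1 z
      obtain ⟨t, ht⟩ := hdd.mfderiv_surjective hyd z
      rw [← ht]
      exact (DFunLike.congr_fun h5 t).symm
    have hnear : d.source ∈ 𝓝 y := d.open_source.mem_nhds hyd
    rw [hi.isEmbedding.nhds_eq_comap, Filter.mem_comap] at hnear
    obtain ⟨V, hV, hVd⟩ := hnear
    filter_upwards [hV]
    rintro _ hy' ⟨y', rfl⟩
    rw [hΛ y' (hVd hy'), hΛ y hyd, ← map_sub]
    exact DFunLike.congr_fun hℓΛ (d y' - d y)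
  · have h1 : ContDiffAt F ω (fun z => ℓ (z - e (i y))) (e (i y)) :=
      ℓ.contDiff.contDiffAt.comp _ (contDiffAt_id.sub contDiffAt_const)
    exact h1.contMDiffAt.comp (i y)
      (contMDiffAt_of_mem_maximalAtlas him.codChart_mem_maximalAtlas hye)

end Analytic

open scoped TensorProduct

/-! ### Functions near the diagonal -/

section Diagonal

/-- Nakayama's lemma at the kernel of a homomorphism `ε` to a field: a finite module without
nonzero `ε`-semilinear functionals is killed by some `e` with `ε e ≠ 0`. -/
lemma exists_smul_eq_zero_of_forall_functional {R K Q : Type*} [CommRing R] [Field K]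
    [AddCommGroup Q] [Module R Q] [Module.Finite R Q] (ε : R →+* K)
    (h : ∀ ψ : Q →+ K, (∀ r m, ψ (r • m) = ε r * ψ m) → ψ = 0) :
    ∃ e, ε e ≠ 0 ∧ ∀ m : Q, e • m = 0 := by
  let p : PrimeSpectrum R := ⟨RingHom.ker ε, RingHom.ker_isPrime ε⟩
  have : p.asIdeal.IsPrime := p.2
  by_cases hp : p ∈ Module.support R Q
  · exfalso
    rw [Module.mem_support_iff_nontrivial_residueField_tensorProduct] at hp
    let κp := p.asIdeal.ResidueField
    obtain ⟨x, hx⟩ := exists_ne (0 : κp ⊗[R] Q)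
    obtain ⟨l, hl⟩ := Module.Projective.exists_dual_ne_zero κp hx
    let j : κp →+* K := Ideal.ResidueField.lift p.asIdeal ε le_rfl fun r hr =>
      isUnit_iff_ne_zero.2 hr
    have hj : ∀ r, j (algebraMap R κp r) = ε r := fun r =>
      Ideal.ResidueField.lift_algebraMap _ _ _ _ _
    have h0 := h (j.toAddMonoidHom.comp (l.toAddMonoidHom.comp
        (TensorProduct.mk R κp Q 1).toAddMonoidHom)) fun r m => by
      simp only [AddMonoidHom.comp_apply, LinearMap.toAddMonoidHom_coe, TensorProduct.mk_apply,
        TensorProduct.tmul_smul, RingHom.toAddMonoidHom_eq_coe, AddMonoidHom.coe_coe]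
      rw [← hj, ← map_mul, algebra_compatible_smul κp r, map_smul, smul_eq_mul]
    have hl0 : ∀ m : Q, l (1 ⊗ₜ m) = 0 := fun m =>
      j.injective ((DFunLike.congr_fun h0 m).trans (map_zero j).symm)
    have hl1 : ∀ x, l x = 0 := fun x => by
      induction x using TensorProduct.induction_on with
      | zero => exact map_zero l
      | tmul a m =>
        rw [← mul_one a, ← smul_eq_mul, ← TensorProduct.smul_tmul', map_smul, hl0, smul_zero]
      | add x y hx hy => rw [map_add, hx, hy, add_zero]
    exact hl (hl1 x)
  · rw [Module.mem_support_iff_of_finite] at hp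
    obtain ⟨e, he, hep⟩ := Set.not_subset.1 hp
    exact ⟨e, hep, fun m => Module.mem_annihilator.1 he m⟩

variable {F A K : Type*} [Field F] [CommRing A] [Algebra F A] [Field K] [Algebra F K]

/-- `D` is an `F`-derivation `A → K` over `ε`. -/
structure IsDerivationAlong (ε : A →ₐ[F] K) (D : A → K) : Prop where
  map_add : ∀ a b, D (a + b) = D a + D b
  map_mul : ∀ a b, D (a * b) = ε a * D b + ε b * D a
  map_algebraMap : ∀ c : F, D (algebraMap F A c) = 0

/-- If the differentials of the functions `gᵢ` generate the cotangent space at a point `ε`, then the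
differences `1 ⊗ gᵢ - gᵢ ⊗ 1` generate the ideal of the diagonal in a neighbourhood of `(ε, ε)`. -/
lemma exists_mul_sub_eq_sum [Algebra.FiniteType F A] {n : ℕ} (ε : A →ₐ[F] K) (g : Fin n → A)
    (hg : ∀ D, IsDerivationAlong ε D → (∀ i, D (g i) = 0) → ∀ a, D a = 0) :
    ∃ e : A ⊗[F] A, Algebra.TensorProduct.productMap ε ε e ≠ 0 ∧ ∀ a : A,
      ∃ B : Fin n → A ⊗[F] A, e * ((1 : A) ⊗ₜ[F] a - a ⊗ₜ[F] (1 : A)) =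
        ∑ i, B i * ((1 : A) ⊗ₜ[F] g i - g i ⊗ₜ[F] (1 : A)) := by
  set I := KaehlerDifferential.ideal F A with hI
  set N : Ideal (A ⊗[F] A) := Ideal.span (Set.range fun i => (1 : A) ⊗ₜ[F] g i - g i ⊗ₜ[F] (1 : A))
  set ε₂ := Algebra.TensorProduct.productMap ε ε
  let δ : A → I := fun a => ⟨(1 : A) ⊗ₜ[F] a - a ⊗ₜ[F] (1 : A),
    KaehlerDifferential.one_smul_sub_smul_one_mem_ideal F a⟩
  have : Module.Finite (A ⊗[F] A) I := Module.Finite.iff_fg.2 (KaehlerDifferential.ideal_fg F A)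
  let Q := I ⧸ Submodule.comap (Submodule.subtype I) N
  obtain ⟨e, he, h⟩ := exists_smul_eq_zero_of_forall_functional (Q := Q) ε₂.toRingHom (by
    intro ψ hψ
    have hD : IsDerivationAlong ε fun a => ψ (Submodule.Quotient.mk (δ a)) :=
      { map_add := fun a b => by
          rw [← map_add, ← Submodule.Quotient.mk_add]
          congr 2
          refine Subtype.ext ?_
          simp only [δ, Submodule.coe_add, TensorProduct.tmul_add, TensorProduct.add_tmul]
          ring
        map_mul := fun a b => by
          have e1 : δ (a * b) = (a ⊗ₜ[F] (1 : A)) • δ b + ((1 : A) ⊗ₜ[F] b) • δ a := by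
            refine Subtype.ext ?_
            simp [δ, mul_sub, mul_comm b a]
          have e2 : ε₂ (a ⊗ₜ[F] (1 : A)) = ε a := by simp [ε₂]
          have e3 : ε₂ ((1 : A) ⊗ₜ[F] b) = ε b := by simp [ε₂]
          rw [e1, Submodule.Quotient.mk_add, map_add, Submodule.Quotient.mk_smul,
            Submodule.Quotient.mk_smul, hψ, hψ, ← e2, ← e3]
          rfl
        map_algebraMap := fun c => by
          have e1 : δ (algebraMap F A c) = 0 := by
            refine Subtype.ext ?_
            simp only [δ, Algebra.algebraMap_eq_smul_one, TensorProduct.tmul_smul,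
              TensorProduct.smul_tmul', sub_self, Submodule.coe_zero]
          rw [e1, Submodule.Quotient.mk_zero, map_zero] }
    have h0 := hg _ hD fun i => by
      have : (Submodule.Quotient.mk (δ (g i)) : Q) = 0 :=
        (Submodule.Quotient.mk_eq_zero _).2 (Ideal.subset_span ⟨i, rfl⟩)
      rw [this, map_zero]
    ext q
    obtain ⟨⟨m, hm⟩, rfl⟩ := Submodule.Quotient.mk_surjective _ q
    change ψ (Submodule.Quotient.mk ⟨m, hm⟩) = 0
    have hm' := hm
    rw [hI, ← KaehlerDifferential.span_range_eq_ideal] at hm'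
    induction hm' using Submodule.span_induction with
    | mem x hx =>
      obtain ⟨a, rfl⟩ := hx
      exact h0 a
    | zero => exact map_zero ψ
    | add x y hx hy ihx ihy =>
      replace hx : x ∈ I := (KaehlerDifferential.span_range_eq_ideal F A).le hx
      replace hy : y ∈ I := (KaehlerDifferential.span_range_eq_ideal F A).le hy
      have := congrArg₂ (· + ·) (ihx hx) (ihy hy)
      simp only [← map_add, add_zero] at this
      exact this
    | smul r x hx ih =>
      replace hx : x ∈ I := (KaehlerDifferential.span_range_eq_ideal F A).le hx
      have := hψ r (Submodule.Quotient.mk ⟨x, hx⟩)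
      rw [ih hx, mul_zero] at this
      exact this)
  refine ⟨e, he, fun a => ?_⟩
  have h1 := h (Submodule.Quotient.mk (δ a))
  rw [← Submodule.Quotient.mk_smul, Submodule.Quotient.mk_eq_zero] at h1
  have h2 : e * ((1 : A) ⊗ₜ[F] a - a ⊗ₜ[F] (1 : A)) ∈ N := h1
  obtain ⟨B, hB⟩ := Ideal.mem_span_range_iff_exists_fun.1 h2
  exact ⟨B, hB.symm⟩

lemma productMap_self (ε : A →ₐ[F] K) (Θ : A ⊗[F] A) :
    Algebra.TensorProduct.productMap ε ε Θ = ε (Algebra.TensorProduct.lmul' F Θ) := by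
  have : Algebra.TensorProduct.productMap ε ε = ε.comp (Algebra.TensorProduct.lmul' F) := by
    ext <;> simp
  rw [this]
  rfl

/-- The identity of `exists_mul_sub_eq_sum` expresses `da` by the `dgᵢ`, by restriction to the first
infinitesimal neighbourhood of the diagonal. -/
lemma IsDerivationAlong.eq_sum {ε : A →ₐ[F] K} {D : A → K} (hD : IsDerivationAlong ε D) {n : ℕ}
    {g : Fin n → A} {a : A} {e : A ⊗[F] A} {B : Fin n → A ⊗[F] A}
    (h : e * ((1 : A) ⊗ₜ[F] a - a ⊗ₜ[F] (1 : A)) =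
      ∑ i, B i * ((1 : A) ⊗ₜ[F] g i - g i ⊗ₜ[F] (1 : A))) :
    ε (Algebra.TensorProduct.lmul' F e) * D a =
      ∑ i, ε (Algebra.TensorProduct.lmul' F (B i)) * D (g i) := by
  let D' : A →ₗ[F] K :=
    { toFun := D
      map_add' := hD.map_add
      map_smul' := fun c a => by
        rw [Algebra.smul_def, hD.map_mul, hD.map_algebraMap, mul_zero, add_zero, AlgHom.commutes,
          RingHom.id_apply, Algebra.smul_def] }
  let T : A ⊗[F] A →ₗ[F] K := LinearMap.mul' F K ∘ₗ TensorProduct.map ε.toLinearMap D'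
  have hT : ∀ (Θ : A ⊗[F] A) (b : A), T (Θ * ((1 : A) ⊗ₜ[F] b - b ⊗ₜ[F] (1 : A))) =
      ε (Algebra.TensorProduct.lmul' F Θ) * D b := by
    intro Θ b
    induction Θ using TensorProduct.induction_on with
    | zero => simp
    | tmul x y =>
      have h1 : D (y * b) = ε y * D b + ε b * D y := hD.map_mul y b
      simp only [mul_sub, Algebra.TensorProduct.tmul_mul_tmul, mul_one, map_sub, T, D',
        LinearMap.comp_apply, TensorProduct.map_tmul, LinearMap.mul'_apply,
        AlgHom.toLinearMap_apply, LinearMap.coe_mk, AddHom.coe_mk, h1, _root_.map_mul,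
        Algebra.TensorProduct.lmul'_apply_tmul]
      ring
    | add x y hx hy => rw [add_mul, _root_.map_add, hx, hy, _root_.map_add, _root_.map_add, add_mul]
  rw [← hT, h, map_sum]
  exact Finset.sum_congr rfl fun i _ => hT _ _

end Diagonal

section StrictDerivative

variable {F : Type u} [NontriviallyNormedField F] [IsUltrametricDist F]
  {A : Type*} [CommRing A] [Algebra F A] {M : Type*} [TopologicalSpace M]

omit [IsUltrametricDist F] in
lemma continuousAt_productMap {p : M} {ε : M → A →ₐ[F] F}
    (hε : ∀ a, ContinuousAt (fun y => ε y a) p) (Θ : A ⊗[F] A) :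
    ContinuousAt (fun q : M × M => Algebra.TensorProduct.productMap (ε q.1) (ε q.2) Θ) (p, p) := by
  induction Θ using TensorProduct.induction_on with
  | zero => simpa using continuousAt_const
  | tmul x y =>
    simp only [Algebra.TensorProduct.productMap_apply_tmul]
    exact ((hε x).comp_of_eq continuousAt_fst rfl).mul ((hε y).comp_of_eq continuousAt_snd rfl)
  | add x y hx hy =>
    simp only [map_add]
    exact hx.add hy

/-- Functions in a finitely generated algebra are strictly differentiable in a chart given by
elements `gᵢ` of the algebra whose differentials generate the cotangent space, and near `p` they
have the differential `∑ βᵢ dgᵢ`.  The identity `e (1 ⊗ s - s ⊗ 1) = ∑ Bᵢ (1 ⊗ gᵢ - gᵢ ⊗ 1)`,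
evaluated at pairs of points, expresses difference quotients of `s` by the continuous functions
`Bᵢ / e`. -/
lemma exists_hasStrictFDerivAt [Algebra.FiniteType F A] {n : ℕ} {p : M} {ε : M → A →ₐ[F] F}
    (hε : ∀ a, ContinuousAt (fun y => ε y a) p) {g : Fin n → A}
    (hg : ∀ D, IsDerivationAlong (ε p) D → (∀ i, D (g i) = 0) → ∀ a, D a = 0)
    {φ : OpenPartialHomeomorph M (Fin n → F)} (hp : p ∈ φ.source)
    (hφ : ∀ᶠ y in 𝓝 p, ∀ i, φ y i = ε y (g i)) (s : A) :
    ∃ β : M → Fin n → F, ContinuousAt β p ∧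
      HasStrictFDerivAt ((fun y => ε y s) ∘ φ.symm) (dotCLM (β p)) (φ p) ∧
      ∀ᶠ y in 𝓝 p, ∀ D, IsDerivationAlong (ε y) D → D s = ∑ i, β y i * D (g i) := by
  obtain ⟨e, he, h⟩ := exists_mul_sub_eq_sum (ε p) g hg
  obtain ⟨B, hB⟩ := h s
  rw [productMap_self] at he
  set β : M → Fin n → F := fun y i => ε y (Algebra.TensorProduct.lmul' F (B i)) /
    ε y (Algebra.TensorProduct.lmul' F e) with hβ
  refine ⟨β, ?_, ?_, ?_⟩
  · exact tendsto_pi_nhds.2 fun i => (hε _).div (hε _) he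
  · set q : M × M → Fin n → F := fun r i => Algebra.TensorProduct.productMap (ε r.1) (ε r.2) (B i) /
      Algebra.TensorProduct.productMap (ε r.1) (ε r.2) e with hq
    have he' : Algebra.TensorProduct.productMap (ε p) (ε p) e ≠ 0 := by rwa [productMap_self]
    have hqp : q (p, p) = β p := by
      ext i
      simp only [hq, hβ, productMap_self]
    have hqc : Filter.Tendsto q (𝓝 (p, p)) (𝓝 (β p)) := by
      rw [← hqp]
      exact tendsto_pi_nhds.2 fun i =>
        (continuousAt_productMap hε _).div (continuousAt_productMap hε _) he'
    have hsymm : Filter.Tendsto φ.symm (𝓝 (φ p)) (𝓝 p) := φ.tendsto_symm hp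
    have hsymm2 : Filter.Tendsto (fun r : (Fin n → F) × (Fin n → F) => (φ.symm r.2, φ.symm r.1))
        (𝓝 (φ p, φ p)) (𝓝 (p, p)) := by
      rw [nhds_prod_eq, nhds_prod_eq]
      exact (hsymm.comp Filter.tendsto_snd).prodMk (hsymm.comp Filter.tendsto_fst)
    have hgood : ∀ᶠ z in 𝓝 (φ p), ∀ i, ε (φ.symm z) (g i) = z i := by
      filter_upwards [hsymm.eventually hφ, φ.open_target.mem_nhds (φ.map_source hp)] with z hz hzt i
      rw [← hz i, φ.right_inv hzt]
    refine .of_isLittleO (Asymptotics.isLittleO_iff.2 fun c hc => ?_)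
    have h1 : ∀ᶠ r in 𝓝 (φ p, φ p), (∀ i, ε (φ.symm r.1) (g i) = r.1 i) ∧
        ∀ i, ε (φ.symm r.2) (g i) = r.2 i := by
      rw [nhds_prod_eq]
      exact (Filter.tendsto_fst.eventually hgood).and (Filter.tendsto_snd.eventually hgood)
    filter_upwards [h1, hsymm2.eventually ((continuousAt_productMap hε e).eventually_ne he'),
      (hqc.comp hsymm2).eventually (Metric.closedBall_mem_nhds _ hc)] with r ⟨hr1, hr2⟩ hre hrq
    rw [Function.comp_apply, dist_eq_norm] at hrq
    -- The identity in `A ⊗ A`, evaluated at the pair of points.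
    have key : ε (φ.symm r.1) s - ε (φ.symm r.2) s = q (φ.symm r.2, φ.symm r.1) ⬝ᵥ (r.1 - r.2) := by
      have := congrArg (Algebra.TensorProduct.productMap (ε (φ.symm r.2)) (ε (φ.symm r.1))) hB
      simp only [map_mul, map_sub, map_sum, Algebra.TensorProduct.productMap_apply_tmul, map_one,
        one_mul, mul_one, hr1, hr2] at this
      rw [dotProduct, ← mul_right_inj' hre, this, Finset.mul_sum]
      refine Finset.sum_congr rfl fun i _ => ?_
      simp only [hq, Pi.sub_apply]
      field_simp
    rw [Function.comp_apply, Function.comp_apply, key, dotCLM_apply, ← sub_dotProduct]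
    exact (norm_dotProduct_le _ _).trans (by gcongr)
  · filter_upwards [(hε _).eventually_ne he] with y hy D hD
    have := hD.eq_sum hB
    rw [← mul_right_inj' hy, this, Finset.mul_sum]
    refine Finset.sum_congr rfl fun i _ => ?_
    simp only [hβ]
    field_simp

end StrictDerivative

/-! ### Functions and derivations on affine open sets -/

section Sections

variable {F : Type u} [Field F] {X : Scheme.{u}}

/-- Restriction of regular functions. -/
noncomputable def restr {U V : X.Opens} (h : V ≤ U) : Γ(X, U) →+* Γ(X, V) :=
  (X.presheaf.map (homOfLE h).op).hom

lemma germ_restr {U V : X.Opens} (h : V ≤ U) {x : X} (hx : x ∈ V) (s : Γ(X, U)) :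
    X.presheaf.germ V x hx (restr h s) = X.presheaf.germ U x (h hx) s :=
  X.presheaf.germ_res_apply (homOfLE h) x hx s

lemma value_restr {f : X ⟶ Spec (CommRingCat.of F)} {K : Type u} [Field K] [Algebra F K]
    (x : Point f K) {U V : X.Opens} (h : V ≤ U) (hx : x.pt ∈ V) (s : Γ(X, U)) :
    x.value V hx (restr h s) = x.value U (h hx) s :=
  congrArg x.ev (germ_restr h hx s)

variable (f : X ⟶ Spec (CommRingCat.of F))

/-- Constant functions. -/
noncomputable def constSection (V : X.Opens) : F →+* Γ(X, V) :=
  (f.appLE ⊤ V le_top).hom.comp (Scheme.ΓSpecIso (CommRingCat.of F)).inv.hom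

lemma germ_constSection {V : X.Opens} {x : X} (hx : x ∈ V) (c : F) :
    X.presheaf.germ V x hx (constSection f V c) = constGerm f x c :=
  X.presheaf.germ_res_apply (homOfLE le_top) x hx _

lemma finiteType_constSection [LocallyOfFiniteType f] {V : X.Opens} (hV : IsAffineOpen V) :
    (constSection f V).FiniteType :=
  (f.finiteType_appLE (isAffineOpen_top _) hV le_top).comp
    (RingHom.FiniteType.of_surjective _
      (Scheme.ΓSpecIso (CommRingCat.of F)).symm.commRingCatIsoToRingEquiv.surjective)

/-- The structure of an `F`-algebra on `Γ(X, V)`. -/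
@[reducible] noncomputable def sectionAlgebra (V : X.Opens) : Algebra F Γ(X, V) :=
  (constSection f V).toAlgebra

variable {f} {K : Type u} [Field K] [Algebra F K] (x : Point f K)

/-- Evaluation at `x` as a homomorphism of `F`-algebras. -/
noncomputable def evalHom {V : X.Opens} (h : x.pt ∈ V) :
    letI := sectionAlgebra f V
    Γ(X, V) →ₐ[F] K :=
  letI := sectionAlgebra f V
  { x.value V h with
    commutes' := fun c => (congrArg x.ev (germ_constSection f h c)).trans (x.ev_const c) }

lemma isDerivationAlong_germ {V : X.Opens} (h : x.pt ∈ V) (D : x.tangent) :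
    letI := sectionAlgebra f V
    IsDerivationAlong (evalHom x h) fun a => D.1 (X.presheaf.germ V x.pt h a) := by
  let := sectionAlgebra f V
  obtain ⟨h₁, h₂, h₃⟩ := D.2
  refine ⟨fun a b => ?_, fun a b => ?_, fun c => ?_⟩
  · rw [map_add, h₁]
  · rw [map_mul, h₂]
    rfl
  · rw [← h₃ c, ← germ_constSection f h c]
    rfl

/-- A derivation of `Γ(X, V)` extends to the local ring, as a homomorphism to the dual numbers. -/
lemma exists_tangent_of_isDerivationAlong {V : X.Opens} (hV : IsAffineOpen V) (h : x.pt ∈ V)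
    {D : Γ(X, V) → K} (hD : letI := sectionAlgebra f V; IsDerivationAlong (evalHom x h) D) :
    ∃ D' : x.tangent, ∀ a, D'.1 (X.presheaf.germ V x.pt h a) = D a := by
  let := sectionAlgebra f V
  let : Algebra Γ(X, V) (X.presheaf.stalk x.pt) := (X.presheaf.germ V x.pt h).hom.toAlgebra
  have hloc : IsLocalization.AtPrime (X.presheaf.stalk x.pt)
      (hV.primeIdealOf ⟨x.pt, h⟩).asIdeal := hV.isLocalization_stalk ⟨x.pt, h⟩
  have := x.isLocalHom_ev
  have h1 : D 1 = 0 := by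
    have := hD.map_mul 1 1
    simpa using this
  have h0 : D 0 = 0 := by
    have := hD.map_add 0 0
    simpa using this
  let Φ : Γ(X, V) →+* TrivSqZeroExt K K :=
    { toFun := fun a => TrivSqZeroExt.inl (evalHom x h a) + TrivSqZeroExt.inr (D a)
      map_one' := by simp [h1]
      map_zero' := by simp [h0]
      map_add' := fun a b => by ext <;> simp [hD.map_add]
      map_mul' := fun a b => by ext <;> simp [hD.map_mul, mul_comm] }
  have hΦ : ∀ a : (hV.primeIdealOf ⟨x.pt, h⟩).asIdeal.primeCompl, IsUnit (Φ a) := by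
    intro a
    have ha : IsUnit (x.ev (algebraMap _ (X.presheaf.stalk x.pt) a.1)) :=
      (IsLocalization.map_units (X.presheaf.stalk x.pt) a).map x.ev
    rw [TrivSqZeroExt.isUnit_iff_isUnit_fst]
    have hfst : (Φ a).fst = x.ev (algebraMap _ (X.presheaf.stalk x.pt) a.1) := by
      simp [Φ]
      rfl
    rwa [hfst]
  let Φ' : X.presheaf.stalk x.pt →+* TrivSqZeroExt K K := IsLocalization.lift hΦ
  have hΦ' : ∀ a, Φ' (X.presheaf.germ V x.pt h a) = Φ a := fun a => IsLocalization.lift_eq hΦ a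
  have hfst : ∀ a, (Φ' a).fst = x.ev a := by
    have : ((TrivSqZeroExt.fstHom K K K).toRingHom.comp Φ') = x.ev := by
      refine IsLocalization.ringHom_ext (hV.primeIdealOf ⟨x.pt, h⟩).asIdeal.primeCompl ?_
      ext a
      change (Φ' (X.presheaf.germ V x.pt h a)).fst = x.ev (X.presheaf.germ V x.pt h a)
      rw [hΦ']
      simp [Φ]
      rfl
    exact fun a => DFunLike.congr_fun this a
  refine ⟨⟨fun a => (Φ' a).snd, fun a b => ?_, fun a b => ?_, fun c => ?_⟩, fun a => ?_⟩
  · simp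
  · simp only [map_mul, TrivSqZeroExt.snd_mul, hfst, smul_eq_mul, MulOpposite.smul_eq_mul_unop,
      MulOpposite.unop_op]
    exact congrArg _ (mul_comm _ _)
  · change (Φ' (constGerm f x.pt c)).snd = 0
    rw [← germ_constSection f h c, hΦ']
    have := hD.map_algebraMap c
    simp only [Φ, RingHom.coe_mk, MonoidHom.coe_mk, OneHom.coe_mk, TrivSqZeroExt.snd_add,
      TrivSqZeroExt.snd_inl, TrivSqZeroExt.snd_inr, zero_add]
    exact this
  · change (Φ' _).snd = _
    rw [hΦ']
    simp [Φ]

lemma covector_apply {n : ℕ} {U : X.Opens} (h : x.pt ∈ U) (g : Fin n → Γ(X, U)) (w : Fin n → K)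
    (D : x.tangent) : x.covector U h g w D = ∑ i, w i * D.1 (X.presheaf.germ U x.pt h (g i)) := by
  simp [Point.covector, Point.differential, LinearMap.sum_apply]

lemma covector_restr {n : ℕ} {U V : X.Opens} (hVU : V ≤ U) (h : x.pt ∈ V) (g : Fin n → Γ(X, U))
    (w : Fin n → K) :
    x.covector V h (fun i => restr hVU (g i)) w = x.covector U (hVU h) g w := by
  simp only [Point.covector, germ_restr]

variable {x}

/-- Derivations at `x` are determined by their values on coordinates. -/
lemma AreCoordinates.eq_zero {n : ℕ} {U V : X.Opens} {h : x.pt ∈ U} {g : Fin n → Γ(X, U)}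
    (hg : x.AreCoordinates U h g) (hVU : V ≤ U) (hV : IsAffineOpen V) (hx : x.pt ∈ V)
    {D : Γ(X, V) → K} (hD : letI := sectionAlgebra f V; IsDerivationAlong (evalHom x hx) D)
    (h0 : ∀ i, D (restr hVU (g i)) = 0) (a : Γ(X, V)) : D a = 0 := by
  obtain ⟨D', hD'⟩ := exists_tangent_of_isDerivationAlong x hV hx hD
  have : D' = 0 := by
    rw [← Module.forall_dual_apply_eq_zero_iff K]
    intro l
    obtain ⟨w, rfl⟩ := hg.2 l
    rw [covector_apply]
    refine Finset.sum_eq_zero fun i _ => ?_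
    rw [← germ_restr hVU hx, hD', h0, mul_zero]
  rw [← hD', this]
  rfl

end Sections

section Topology

variable {F : Type u} [NontriviallyNormedField F] {X : Scheme.{u}}
  {f : X ⟶ Spec (CommRingCat.of F)}

lemma isOpen_setOf_value_mem {U : X.Opens} (s : Γ(X, U)) {O : Set F} (hO : IsOpen O) :
    IsOpen {x : Point f F | ∃ h : x.pt ∈ U, x.value U h s ∈ O} :=
  TopologicalSpace.isOpen_generateFrom_of_mem ⟨U, s, O, hO, rfl⟩

lemma isOpen_setOf_pt_mem (U : X.Opens) : IsOpen {x : Point f F | x.pt ∈ U} := by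
  convert isOpen_setOf_value_mem (f := f) (0 : Γ(X, U)) isOpen_univ
  simp

end Topology

/-! ### The wave front set on an algebraic variety -/

section AlgebraicWaveFront

variable {F : Type u} [NontriviallyNormedField F] [IsUltrametricDist F] [ProperSpace F]
  {X : Scheme.{u}} {f : X ⟶ Spec (CommRingCat.of F)} {κ : AddChar F Circle}

omit [ProperSpace F] in
/-- In a chart given by algebraic coordinates, a regular function `s` is strictly differentiable,
with differential `ds = ∑ βᵢ dgᵢ`. -/
lemma exists_regular_hasStrictFDerivAt [LocallyOfFiniteType f] {n : ℕ}
    {e : OpenPartialHomeomorph (Point f F) (Fin n → F)} {U V : X.Opens} {g : Fin n → Γ(X, U)}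
    (he : IsAlgebraicChart e U g) {p : Point f F} (hp : p ∈ e.source) (hVU : V ≤ U)
    (hV : IsAffineOpen V) (hpV : p.pt ∈ V) (s : Γ(X, V)) :
    ∃ (h : Point f F → F) (β : Point f F → Fin n → F),
      (∀ y (hy : y.pt ∈ V), h y = y.value V hy s) ∧ ContinuousAt β p ∧
      HasStrictFDerivAt (h ∘ e.symm) (dotCLM (β p)) (e p) ∧
      ∀ᶠ y in 𝓝 p, ∃ hy : y.pt ∈ V, y.differential (X.presheaf.germ V y.pt hy s) =
        y.covector U (hVU hy) g (β y) := by
  classical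
  let := sectionAlgebra f V
  have : Algebra.FiniteType F Γ(X, V) := finiteType_constSection f hV
  let ε : Point f F → Γ(X, V) →ₐ[F] F := fun y =>
    if hy : y.pt ∈ V then evalHom y hy else evalHom p hpV
  have hε : ∀ y (hy : y.pt ∈ V), ε y = evalHom y hy := fun y hy => dif_pos hy
  have hVnear : ∀ᶠ y in 𝓝 p, y.pt ∈ V := (isOpen_setOf_pt_mem V).mem_nhds hpV
  have hcont : ∀ a, ContinuousAt (fun y => ε y a) p := by
    intro a
    refine tendsto_nhds.2 fun O hO hpO => ?_
    have hpO' : p.value V hpV a ∈ O := by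
      have h1 : ε p a ∈ O := hpO
      rw [hε p hpV] at h1
      exact h1
    filter_upwards [(isOpen_setOf_value_mem a hO).mem_nhds ⟨hpV, hpO'⟩] with y ⟨hy, hyO⟩
    rw [Set.mem_preimage, hε y hy]
    exact hyO
  obtain ⟨hpU, -, hg⟩ := he p hp
  obtain ⟨β, hβ, hstrict, hD⟩ := exists_hasStrictFDerivAt (p := p) (ε := ε) hcont
    (g := fun i => restr hVU (g i)) (by
      intro D hD h0
      rw [hε p hpV] at hD
      exact AreCoordinates.eq_zero hg hVU hV hpV hD h0) hp (by
      filter_upwards [e.open_source.mem_nhds hp, hVnear] with y hy hyV i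
      obtain ⟨hyU, hval, -⟩ := he y hy
      rw [hval i, hε y hyV]
      exact (value_restr y hVU hyV (g i)).symm) s
  refine ⟨fun y => ε y s, β, fun y hy => DFunLike.congr_fun (hε y hy) s, hβ, hstrict, ?_⟩
  filter_upwards [hVnear, hD] with y hyV hD
  refine ⟨hyV, LinearMap.ext fun D => ?_⟩
  have h1 := isDerivationAlong_germ y hyV D
  rw [← hε y hyV] at h1
  rw [covector_apply]
  refine (hD _ h1).trans (Finset.sum_congr rfl fun i _ => ?_)
  rw [germ_restr]

/-- The wave front set at `p` is invariant under the differential of any regular function that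
vanishes on the support of the distribution. -/
theorem algWaveFrontSet_add_differential [LocallyOfFiniteType f] (hκ : Continuous κ)
    (hκ_ne : κ ≠ 1) {E : LocallyConstantSheaf.{u, w} (Point f F)} {ξ : E.Distribution}
    {p : Point f F} {U : X.Opens} (hpU : p.pt ∈ U) {s : Γ(X, U)}
    (hs : ∀ y ∈ support ξ, ∀ hy : y.pt ∈ U, y.value U hy s = 0) {v : p.cotangent}
    (hv : (⟨p, v⟩ : Cotangent f F) ∈ algWaveFrontSet κ ξ) :
    (⟨p, v + p.differential (X.presheaf.germ U p.pt hpU s)⟩ : Cotangent f F) ∈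
      algWaveFrontSet κ ξ := by
  rintro ⟨n, e, U₀, g, he, hpe, hpU₀, w, hsm, hw⟩
  refine hv ?_
  obtain ⟨V, hV, hpV, hVU'⟩ := exists_isAffineOpen_mem_and_subset (U := U ⊓ U₀)
    (show p.pt ∈ U ⊓ U₀ from ⟨hpU, hpU₀⟩)
  have hVU : V ≤ U := fun x hx => (hVU' hx).1
  have hVU₀ : V ≤ U₀ := fun x hx => (hVU' hx).2
  have hVnear : ∀ᶠ y : Point f F in 𝓝 p, y.pt ∈ V := (isOpen_setOf_pt_mem V).mem_nhds hpV
  set σ := restr hVU s with hσ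
  obtain ⟨h, β, hh, hβ, hstrict, hd⟩ := exists_regular_hasStrictFDerivAt he hpe hVU₀ hV hpV σ
  have h0 : ∀ᶠ y in 𝓝 p, y ∈ support ξ → h y = 0 := by
    filter_upwards [hVnear] with y hyV hys
    rw [hh y hyV, hσ, value_restr, hs y hys]
  obtain ⟨_, hdp⟩ := hd.self_of_nhds
  rw [hσ, germ_restr] at hdp
  have hcoord := (he p hpe).choose_spec.2
  -- Smoothness at `v + ds` implies smoothness at `v`.
  rcases hsm.vanishesNear_or_exists hκ hκ_ne hpe h0 hstrict with hvan | ⟨u, hwu, hau⟩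
  · obtain ⟨w', hw'⟩ := hcoord.2 v
    exact ⟨n, e, U₀, g, he, hpe, hpU₀, w', hvan.isSmoothInChart hpe w', hw'.symm⟩
  have hΦ := hasStrictFDerivAt_shear hstrict u hau
  set Ψ := hΦ.toOpenPartialHomeomorph _ with hΨ
  have hΨcoe : ∀ z, Ψ z = z - (h ∘ e.symm) z • u := fun z => rfl
  have hau' : ∀ᶠ y in 𝓝 p, u ⬝ᵥ β y ≠ 1 := by
    have hc : ContinuousAt (fun y => u ⬝ᵥ β y) p :=
      tendsto_finsetSum _ fun i _ => tendsto_const_nhds.mul (tendsto_pi_nhds.1 hβ i)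
    exact hc.eventually_ne (by rwa [dotProduct_comm])
  obtain ⟨O, hO, hOo, hpO⟩ := eventually_nhds_iff.1 (hd.and hau')
  -- The new coordinates `gᵢ - uᵢ s`.
  let g' : Fin n → Γ(X, V) := fun i => restr hVU₀ (g i) - constSection f V (u i) * σ
  have hcov : ∀ (y : Point f F) (hy : y.pt ∈ V) (w : Fin n → F),
      y.covector V hy g' w = y.covector U₀ (hVU₀ hy) g w -
        (w ⬝ᵥ u) • y.differential (X.presheaf.germ V y.pt hy σ) := by
    intro y hy w
    refine LinearMap.ext fun D => ?_
    let := sectionAlgebra f V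
    have hD := isDerivationAlong_germ y hy D
    have hD' : ∀ i, D.1 (X.presheaf.germ V y.pt hy (g' i)) =
        D.1 (X.presheaf.germ U₀ y.pt (hVU₀ hy) (g i)) -
          u i * D.1 (X.presheaf.germ V y.pt hy σ) := by
      intro i
      have h1 : restr hVU₀ (g i) = g' i + algebraMap F Γ(X, V) (u i) * σ :=
        (sub_add_cancel _ _).symm
      have h2 := hD.map_add (g' i) (algebraMap F Γ(X, V) (u i) * σ)
      rw [← h1, hD.map_mul, hD.map_algebraMap, mul_zero, add_zero, AlgHom.commutes,
        germ_restr] at h2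
      exact eq_sub_of_add_eq h2.symm
    rw [LinearMap.sub_apply, LinearMap.smul_apply, covector_apply, covector_apply, dotProduct,
      smul_eq_mul, Finset.sum_mul, ← Finset.sum_sub_distrib]
    refine Finset.sum_congr rfl fun i _ => ?_
    rw [hD' i]
    change _ = _ - w i * u i * D.1 (X.presheaf.germ V y.pt hy σ)
    ring
  set ψ := (e.trans Ψ).restrOpen O hOo with hψ
  have hψcoe : ∀ y ∈ e.source, ψ y = e y - h y • u := by
    intro y hy
    change Ψ (e y) = _
    rw [hΨcoe, Function.comp_apply, e.left_inv hy]
  have hpψ : p ∈ ψ.source := ⟨⟨hpe, hΦ.mem_toOpenPartialHomeomorph_source⟩, hpO⟩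
  refine ⟨n, ψ, V, g', ?_, hpψ, hpV, w, hsm.congr_chart hκ hpψ ?_, ?_⟩
  · rintro y ⟨⟨hye, -⟩, hyO⟩
    obtain ⟨⟨hyV, hdy⟩, huy⟩ := hO y hyO
    obtain ⟨hyU₀, hval, hcoord⟩ := he y hye
    refine ⟨hyV, fun i => ?_, ?_⟩
    · have h1 : y.value V hyV (constSection f V (u i)) = u i :=
        (congrArg y.ev (germ_constSection f hyV (u i))).trans (y.ev_const (u i))
      rw [hψcoe y hye, Pi.sub_apply, Pi.smul_apply, hval i, map_sub, map_mul, h1, hh y hyV,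
        value_restr y hVU₀ hyV (g i), smul_eq_mul, mul_comm]
    · have h1 : y.covector V hyV g' = y.covector U₀ hyU₀ g ∘ shearEquiv u (β y) huy := by
        ext1 w'
        rw [hcov, hdy, Function.comp_apply, shearEquiv_apply]
        refine LinearMap.ext fun D => ?_
        simp only [LinearMap.sub_apply, LinearMap.smul_apply, covector_apply, Pi.sub_apply,
          Pi.smul_apply, sub_mul, Finset.sum_sub_distrib, smul_eq_mul, mul_assoc,
          ← Finset.mul_sum, dotProduct_comm u w']
      rw [Point.AreCoordinates, h1]
      exact hcoord.comp (shearEquiv u (β y) huy).bijective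
  · filter_upwards [h0, e.open_source.mem_nhds hpe] with y hy hye hys
    rw [hψcoe y hye, hy hys, zero_smul, sub_zero]
  · rw [hcov, hwu, one_smul, hσ, germ_restr, ← hw, add_sub_cancel_right]

end AlgebraicWaveFront

/-! ### Conormal covectors as differentials -/

section Conormal

variable {F : Type u} [Field F] {X : Scheme.{u}} {f : X ⟶ Spec (CommRingCat.of F)}
  {K : Type u} [Field K] [Algebra F K]

lemma finiteDimensional_cotangent {x : Point f K} {n : ℕ} {U : X.Opens} {h : x.pt ∈ U}
    {g : Fin n → Γ(X, U)} (hg : x.AreCoordinates U h g) : FiniteDimensional K x.cotangent := by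
  let L : (Fin n → K) →ₗ[K] x.cotangent :=
    { toFun := x.covector U h g
      map_add' := fun a b => by
        refine LinearMap.ext fun D => ?_
        simp only [covector_apply, LinearMap.add_apply, Pi.add_apply, add_mul,
          Finset.sum_add_distrib]
      map_smul' := fun r a => by
        refine LinearMap.ext fun D => ?_
        simp only [covector_apply, LinearMap.smul_apply, Pi.smul_apply, smul_eq_mul, mul_assoc,
          Finset.mul_sum, RingHom.id_apply] }
  exact Module.Finite.of_surjective L hg.2

/-- Double annihilators: a covector killing all tangent vectors on which the functions in `S` have
derivative `0` is a linear combination of the differentials of these functions. -/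
lemma mem_span_differential {x : Point f K} [FiniteDimensional K x.cotangent]
    {S : Set (X.presheaf.stalk x.pt)} {c : x.cotangent}
    (hc : ∀ D : x.tangent, (∀ a ∈ S, D.1 a = 0) → c D = 0) :
    c ∈ Submodule.span K (x.differential '' S) := by
  rw [← Subspace.dualCoannihilator_dualAnnihilator_eq
    (W := Submodule.span K (x.differential '' S)), Submodule.mem_dualAnnihilator]
  intro D hD
  refine hc D fun a ha => ?_
  rw [Submodule.mem_dualCoannihilator] at hD
  exact hD _ (Submodule.subset_span ⟨a, ha, rfl⟩)

lemma differential_constSection_mul {x : Point f K} {U : X.Opens} (h : x.pt ∈ U) (c : F)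
    (s : Γ(X, U)) : x.differential (X.presheaf.germ U x.pt h (constSection f U c * s)) =
      algebraMap F K c • x.differential (X.presheaf.germ U x.pt h s) := by
  refine LinearMap.ext fun D => ?_
  let := sectionAlgebra f U
  have hD := isDerivationAlong_germ x h D
  have h1 := hD.map_mul (algebraMap F Γ(X, U) c) s
  rw [hD.map_algebraMap, mul_zero, add_zero, AlgHom.commutes] at h1
  exact h1

/-- A conormal covector of a subscheme is in the span of the differentials of the functions in its
ideal. -/
lemma mem_span_of_mem_conormal {Y : Scheme.{u}} (i : Y ⟶ X) [IsPreimmersion i]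
    {y : Point (i ≫ f) K} [FiniteDimensional K (y.map i).cotangent] {c : (y.map i).cotangent}
    (hc : c ∈ y.conormal i) : c ∈ Submodule.span K ((y.map i).differential ''
      {a | (i.stalkMap y.pt).hom a = 0}) := by
  refine mem_span_differential fun D hD => ?_
  let θ : X.presheaf.stalk (y.map i).pt →+* Y.presheaf.stalk y.pt := (i.stalkMap y.pt).hom
  have hsurj : Function.Surjective θ := i.stalkMap_surjective y.pt
  obtain ⟨h₁, h₂, h₃⟩ := D.2
  -- `D` factors through the local ring of the subscheme.
  have hwd : ∀ a b, θ a = θ b → D.1 a = D.1 b := by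
    intro a b hab
    have h := h₁ (a - b) b
    rwa [sub_add_cancel, hD (a - b) (show θ (a - b) = 0 by rw [map_sub, hab, sub_self]),
      zero_add] at h
  choose l hl using hsurj
  have hev : ∀ a, (y.map i).ev (l a) = y.ev a := fun a => congrArg y.ev (hl a)
  let D' : y.tangent := ⟨fun b => D.1 (l b), fun a b => by
      rw [← h₁]
      exact hwd _ _ (by rw [hl, map_add, hl, hl]), fun a b => by
      rw [← hev a, ← hev b, ← h₂]
      exact hwd _ _ (by rw [hl, map_mul, hl, hl]), fun c => by
      rw [← h₃ c]
      exact hwd _ _ ((hl _).trans (stalkMap_constGerm i y.pt c).symm)⟩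
  have hD' : y.tangentMap i D' = D := Subtype.ext (funext fun a => hwd _ _ (hl _))
  rw [Point.conormal, Submodule.mem_dualAnnihilator] at hc
  exact hc D ⟨D', hD'⟩

/-- Functions in the ideal of a subscheme at a point vanish on the subscheme near this point. -/
lemma exists_eq_zero_on_range_of_stalkMap_eq_zero {Y : Scheme.{u}} (i : Y ⟶ X) [IsPreimmersion i]
    (y : Y) {a : X.presheaf.stalk (i y)} (ha : (i.stalkMap y).hom a = 0) :
    ∃ (U : X.Opens) (h : i y ∈ U) (s : Γ(X, U)), X.presheaf.germ U (i y) h s = a ∧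
      ∀ (z : Point (i ≫ f) K) (hz : (z.map i).pt ∈ U), (z.map i).value U hz s = 0 := by
  obtain ⟨U, hU, s, rfl⟩ := X.presheaf.exists_germ_eq a
  have h1 : Y.presheaf.germ (i ⁻¹ᵁ U) y hU ((i.app U).hom s) =
      Y.presheaf.germ (i ⁻¹ᵁ U) y hU 0 := by
    rw [map_zero, ← ha]
    exact (Scheme.Hom.germ_stalkMap_apply i U y hU s).symm
  obtain ⟨V, hyV, j, j', hV⟩ := Y.presheaf.germ_eq y hU hU _ _ h1
  obtain ⟨O, hO, hOV⟩ := i.isEmbedding.isInducing.isOpen_iff.1 V.2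
  let U' : X.Opens := U ⊓ ⟨O, hO⟩
  have hU'U : U' ≤ U := inf_le_left
  have hVO : ∀ z, i z ∈ O ↔ z ∈ V := fun z => Set.ext_iff.1 hOV z
  refine ⟨U', ⟨hU, (hVO y).2 hyV⟩, restr hU'U s, germ_restr _ _ _, fun z hz => ?_⟩
  rw [value_restr]
  have hzV : z.pt ∈ V := (hVO _).1 hz.2
  have h2 : (i.stalkMap z.pt).hom (X.presheaf.germ U (i z.pt) hz.1 s) = 0 := by
    have h3 := Scheme.Hom.germ_stalkMap_apply i U z.pt hz.1 s
    have h4 := Y.presheaf.germ_res_apply j z.pt hzV ((i.app U).hom s)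
    have h5 := Y.presheaf.germ_res_apply j' z.pt hzV (0 : Γ(Y, i ⁻¹ᵁ U))
    exact h3.trans (h4.symm.trans ((congrArg _ hV).trans (h5.trans (map_zero _))))
  exact (congrArg z.ev h2).trans (map_zero z.ev)

end Conormal

section AlgebraicInvariance

variable {F : Type u} [NontriviallyNormedField F] [IsUltrametricDist F] [ProperSpace F]
  {X : Scheme.{u}} {f : X ⟶ Spec (CommRingCat.of F)} [LocallyOfFiniteType f]
  {κ : AddChar F Circle} {E : LocallyConstantSheaf.{u, w} (Point f F)} {ξ : E.Distribution}

lemma algWaveFrontSet_add_smul_differential (hκ : Continuous κ)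
    (hκ_ne : κ ≠ 1) {p : Point f F} {U : X.Opens} (hpU : p.pt ∈ U) {s : Γ(X, U)}
    (hs : ∀ y ∈ support ξ, ∀ hy : y.pt ∈ U, y.value U hy s = 0) (r : F) {v : p.cotangent}
    (hv : (⟨p, v⟩ : Cotangent f F) ∈ algWaveFrontSet κ ξ) :
    (⟨p, v + r • p.differential (X.presheaf.germ U p.pt hpU s)⟩ : Cotangent f F) ∈
      algWaveFrontSet κ ξ := by
  have := algWaveFrontSet_add_differential hκ hκ_ne hpU (s := constSection f U r * s)
    (fun y hy hyU => by rw [map_mul, hs y hy hyU, mul_zero]) hv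
  rwa [differential_constSection_mul] at this

/-- A conormal covector is a combination of differentials of functions vanishing on the subscheme,
so the shift by it is a composition of shifts by such differentials. -/
theorem algWaveFrontSet_add_conormal (hκ : Continuous κ) (hκ_ne : κ ≠ 1) {Y : Scheme.{u}}
    (i : Y ⟶ X) [IsPreimmersion i]
    (hξ : support ξ ⊆ Set.range (Point.map (f := f) (K := F) i)) (y : Point (i ≫ f) F)
    {v c : (y.map i).cotangent} (hc : c ∈ y.conormal i)
    (hv : (⟨y.map i, v⟩ : Cotangent f F) ∈ algWaveFrontSet κ ξ) :
    (⟨y.map i, v + c⟩ : Cotangent f F) ∈ algWaveFrontSet κ ξ := by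
  by_cases hfin : FiniteDimensional F (y.map i).cotangent
  · suffices h : ∀ (r : F) (v : (y.map i).cotangent),
        (⟨y.map i, v⟩ : Cotangent f F) ∈ algWaveFrontSet κ ξ →
          (⟨y.map i, v + r • c⟩ : Cotangent f F) ∈ algWaveFrontSet κ ξ by
      simpa using h 1 v hv
    have hspan := mem_span_of_mem_conormal i hc
    clear hc
    induction hspan using Submodule.span_induction with
    | mem c hc =>
      obtain ⟨a, ha, rfl⟩ := hc
      obtain ⟨U, hU, s, rfl, hs⟩ := exists_eq_zero_on_range_of_stalkMap_eq_zero (f := f) (K := F)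
        i y.pt ha
      intro r v hv
      refine algWaveFrontSet_add_smul_differential hκ hκ_ne hU (fun z hz hzU => ?_) r hv
      obtain ⟨z', rfl⟩ := hξ hz
      exact hs z' hzU
    | zero => simp
    | add c c' _ _ h h' =>
      intro r v hv
      have := h' r _ (h r v hv)
      rwa [add_assoc, ← smul_add] at this
    | smul t c _ h =>
      intro r v hv
      rw [smul_smul]
      exact h _ v hv
  -- Smoothness at a covector includes that there are local coordinates at the point.
  · rintro ⟨n, e, U, g, he, hpe, -⟩
    exact hfin (finiteDimensional_cotangent (he _ hpe).choose_spec.2)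

end AlgebraicInvariance

/-! ### The singular support -/

section Zariski

variable {F : Type u} [Field F] {X : Scheme.{u}} {f : X ⟶ Spec (CommRingCat.of F)}
  {K : Type u} [Field K] [Algebra F K]

lemma subset_zariskiClosure (S : Set (Cotangent f K)) : S ⊆ zariskiClosure S :=
  fun _ hq _ _ _ _ _ _ hP => hP _ hq

lemma covector_add_smul {x : Point f K} {n : ℕ} {U : X.Opens} (h : x.pt ∈ U)
    (g : Fin n → Γ(X, U)) (a b : Fin n → K) (r : K) :
    x.covector U h g (a + r • b) = x.covector U h g a + r • x.covector U h g b := by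
  refine LinearMap.ext fun D => ?_
  simp only [covector_apply, LinearMap.add_apply, LinearMap.smul_apply, Pi.add_apply,
    Pi.smul_apply, smul_eq_mul, add_mul, Finset.sum_add_distrib, Finset.mul_sum, mul_assoc]

/-- If the part of `S` over `U` is invariant under the shifts by the multiples of `ds` with values
of regular functions as factors, then the Zariski closure of `S` is invariant under the shifts by
all its `K`-multiples: an equation of the closure, along the line of these shifts, is a polynomial with
infinitely many roots. -/
lemma zariskiClosure_add_smul_differential [LocallyOfFiniteType f] [Infinite F]
    {S : Set (Cotangent f K)} {U : X.Opens} {s : Γ(X, U)}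
    (hS : ∀ (z : Point f K) (h : z.pt ∈ U) (v : z.cotangent), (⟨z, v⟩ : Cotangent f K) ∈ S →
      ∀ (V : X.Opens) (hV : z.pt ∈ V) (φ : Γ(X, V)), (⟨z, v + z.value V hV φ • z.differential
        (X.presheaf.germ U z.pt h s)⟩ : Cotangent f K) ∈ S)
    {x : Point f K} (h : x.pt ∈ U) {y : x.cotangent}
    (hy : (⟨x, y⟩ : Cotangent f K) ∈ zariskiClosure S) (r : K) :
    (⟨x, y + r • x.differential (X.presheaf.germ U x.pt h s)⟩ : Cotangent f K) ∈
      zariskiClosure S := by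
  intro U' hU' n g hg P hP hxU' a ha
  obtain ⟨V, hV, hxV, hVU''⟩ := exists_isAffineOpen_mem_and_subset (U := U ⊓ U')
    (show x.pt ∈ U ⊓ U' from ⟨h, hxU'⟩)
  have hVU : V ≤ U := fun z hz => (hVU'' hz).1
  have hVU' : V ≤ U' := fun z hz => (hVU'' hz).2
  let := sectionAlgebra f V
  have : Algebra.FiniteType F Γ(X, V) := finiteType_constSection f hV
  obtain ⟨e, he, hB⟩ := exists_mul_sub_eq_sum (evalHom x hxV) (fun i => restr hVU' (g i))
    (fun D hD h0 => AreCoordinates.eq_zero (hg x hxU') hVU' hV hxV hD h0)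
  obtain ⟨B, hB⟩ := hB (restr hVU s)
  rw [productMap_self] at he
  -- On `V` the multiple `φ ds` is the combination `∑ bᵢ dgᵢ`, and `φ` is invertible at `x`.
  set φ : Γ(X, V) := Algebra.TensorProduct.lmul' F e
  set b : Fin n → Γ(X, V) := fun i => Algebra.TensorProduct.lmul' F (B i)
  have hφ : x.value V hxV φ ≠ 0 := he
  have hd : ∀ (z : Point f K) (hz : z.pt ∈ V),
      z.value V hz φ • z.differential (X.presheaf.germ U z.pt (hVU hz) s) =
        z.covector U' (hVU' hz) g fun i => z.value V hz (b i) := by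
    intro z hz
    refine LinearMap.ext fun D => ?_
    have h1 := (isDerivationAlong_germ z hz D).eq_sum hB
    simp only [germ_restr] at h1
    rw [covector_apply]
    exact h1
  -- Shifts by multiples of `φ ds` act on functions on the cotangent bundle.
  let T : F → MvPolynomial (Fin n) Γ(X, V) := fun t => P.eval₂ (MvPolynomial.C.comp (restr hVU'))
    fun i => MvPolynomial.X i + MvPolynomial.C (constSection f V t * b i)
  have hT : ∀ (t : F) (z : Point f K) (hz : z.pt ∈ V) (a' : Fin n → K),
      (T t).eval₂ (z.value V hz) a' = P.eval₂ (z.value U' (hVU' hz))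
        (a' + algebraMap F K t • fun i => z.value V hz (b i)) := by
    intro t z hz a'
    have h1 := MvPolynomial.eval₂_comp_left (MvPolynomial.eval₂Hom (z.value V hz) a')
      (MvPolynomial.C.comp (restr hVU'))
      (fun i => MvPolynomial.X i + MvPolynomial.C (constSection f V t * b i)) P
    refine h1.trans ?_
    congr 1
    · ext c
      simpa using value_restr z hVU' hz c
    · ext i
      have h2 : z.value V hz (constSection f V t) = algebraMap F K t :=
        (congrArg z.ev (germ_constSection f hz t)).trans (z.ev_const t)
      simp [h2, Algebra.smul_def]
  have hTS : ∀ t, ∀ q ∈ S, VanishesAt V (fun i => restr hVU' (g i)) (T t) q := by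
    rintro t ⟨z, v⟩ hq hz a' ha'
    rw [hT]
    have h1 := hS z (hVU hz) v hq V hz (constSection f V t * φ)
    refine hP _ h1 (hVU' hz) _ ?_
    rw [covector_restr] at ha'
    have h2 : z.value V hz (constSection f V t) = algebraMap F K t :=
      (congrArg z.ev (germ_constSection f hz t)).trans (z.ev_const t)
    rw [covector_add_smul, ha', ← hd z hz, map_mul, h2, mul_smul]
  set r' : K := r / x.value V hxV φ with hr'
  set bx : Fin n → K := fun i => x.value V hxV (b i) with hbx
  set a₀ : Fin n → K := a + (-r') • bx with ha₀
  have ha₀y : x.covector U' hxU' g a₀ = y := by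
    have h1 : r' * x.value V hxV φ = r := div_mul_cancel₀ _ hφ
    rw [ha₀, covector_add_smul, ha, hbx, ← hd x hxV, smul_smul, neg_mul, h1]
    exact (congrArg (_ + ·) (neg_smul _ _)).trans (add_neg_cancel_right _ _)
  let p : Polynomial K := P.eval₂ (Polynomial.C.comp (x.value U' hxU'))
    fun i => Polynomial.C (a₀ i) + Polynomial.C (bx i) * Polynomial.X
  have hp : ∀ t : K, p.eval t = P.eval₂ (x.value U' hxU') (a₀ + t • bx) := by
    intro t
    refine (MvPolynomial.eval₂_comp_left (Polynomial.evalRingHom t) _ _ P).trans ?_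
    congr 1
    · ext c
      simp
    · ext i
      simp [mul_comm t]
  have hp0 : p = 0 := by
    refine Polynomial.eq_zero_of_infinite_isRoot p (Set.Infinite.mono ?_
      (Set.infinite_range_of_injective (algebraMap F K).injective))
    rintro _ ⟨t, rfl⟩
    have h1 := hy V hV n (fun i => restr hVU' (g i)) (fun z hz => by
      have := hg z (hVU' hz)
      rwa [Point.AreCoordinates, show z.covector V hz (fun i => restr hVU' (g i)) =
        z.covector U' (hVU' hz) g from funext (covector_restr z hVU' hz g)]) (T t) (hTS t) hxV a₀
      (by rw [covector_restr, ha₀y])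
    rw [hT] at h1
    exact (hp _).trans h1
  have h1 := hp r'
  rw [hp0, Polynomial.eval_zero, ha₀, add_assoc, ← add_smul, neg_add_cancel, zero_smul,
    add_zero] at h1
  exact h1.symm

end Zariski

section WeaklyCoisotropic

variable {F : Type u} [NontriviallyNormedField F] [IsUltrametricDist F] [ProperSpace F]
  {X : Scheme.{u}} {f : X ⟶ Spec (CommRingCat.of F)} {κ : AddChar F Circle}
  {E : LocallyConstantSheaf.{u, w} (Point f F)} {ξ : E.Distribution}

/-- The wave front set contains the zero covectors over the support: a distribution that is smooth
at the covector `0` vanishes near the point. -/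
lemma mk_zero_mem_algWaveFrontSet (hκ : Continuous κ) (hκ_ne : κ ≠ 1) {p : Point f F}
    (hp : p ∈ support ξ) : (⟨p, 0⟩ : Cotangent f F) ∈ algWaveFrontSet κ ξ := by
  rintro ⟨n, e, U, g, he, hpe, hpU, w, hsm, hw⟩
  have hw0 : w = 0 := by
    obtain ⟨h, -, hcoord⟩ := he p hpe
    refine hcoord.1 (hw.symm.trans ?_)
    simp [Point.covector]
  subst hw0
  refine (hsm.vanishesNear hκ hκ_ne fun ε hε => ⟨Set.univ, Filter.univ_mem, ?_⟩).notMem_support hp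
  intro y _ z _ _ _
  rw [zero_dotProduct, norm_zero]
  positivity

/-- Shifts by differentials of functions vanishing on the support preserve the extension of the wave
front set to `K`-points, with values of regular functions as coefficients. -/
lemma extendCotangent_add_smul_differential [LocallyOfFiniteType f] (hκ : Continuous κ)
    (hκ_ne : κ ≠ 1) {K : Type u} [Field K] [Algebra F K] {U : X.Opens} {s : Γ(X, U)}
    (hs : ∀ y ∈ support ξ, ∀ hy : y.pt ∈ U, y.value U hy s = 0) {z : Point f K} (h : z.pt ∈ U)
    {v : z.cotangent} (hv : (⟨z, v⟩ : Cotangent f K) ∈ extendCotangent K (algWaveFrontSet κ ξ))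
    {V : X.Opens} (hV : z.pt ∈ V) (φ : Γ(X, V)) :
    (⟨z, v + z.value V hV φ • z.differential (X.presheaf.germ U z.pt h s)⟩ : Cotangent f K) ∈
      extendCotangent K (algWaveFrontSet κ ξ) := by
  obtain ⟨⟨p, v₀⟩, hp, v', hv', hq⟩ := hv
  cases hq
  refine ⟨⟨p, v₀ + p.value V hV φ • p.differential (X.presheaf.germ U p.pt h s)⟩,
    algWaveFrontSet_add_smul_differential hκ hκ_ne h hs _ hp, _, fun D D' hD => ?_, rfl⟩
  have h1 : (p.extend K).differential (X.presheaf.germ U p.pt h s) D' =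
      algebraMap F K (p.differential (X.presheaf.germ U p.pt h s) D) := hD _
  have h2 : (p.extend K).value V hV φ = algebraMap F K (p.value V hV φ) := rfl
  refine (congrArg₂ (· + ·) (hv' D D' hD) (congrArg₂ (· * ·) h2 h1)).trans ?_
  rw [← map_mul, ← map_add]
  rfl

/-- The singular support is invariant under shifts by conormal covectors of its projection. -/
theorem singularSupport_add_conormalOf [LocallyOfFiniteType f] (hκ : Continuous κ)
    (hκ_ne : κ ≠ 1) {x : Point f (AlgebraicClosure F)}
    (hx : x ∈ Sigma.fst '' singularSupport κ ξ) {c : x.cotangent}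
    (hc : c ∈ x.conormalOf (Sigma.fst '' singularSupport κ ξ)) {y : x.cotangent}
    (hy : (⟨x, y⟩ : Cotangent f (AlgebraicClosure F)) ∈ singularSupport κ ξ) :
    (⟨x, y + c⟩ : Cotangent f (AlgebraicClosure F)) ∈ singularSupport κ ξ := by
  by_cases hfin : FiniteDimensional (AlgebraicClosure F) x.cotangent
  · set W : Set (Point f (AlgebraicClosure F)) := Sigma.fst '' singularSupport κ ξ with hW
    -- The generators of the vanishing ideal have the same common kernel as the whole ideal.
    have hspan : c ∈ Submodule.span (AlgebraicClosure F) (x.differential ''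
        {a | ∃ (U : X.Opens) (h : x.pt ∈ U) (s : Γ(X, U)), X.presheaf.germ U x.pt h s = a ∧
          ∀ y ∈ W, ∀ hy : y.pt ∈ U, y.value U hy s = 0}) := by
      refine mem_span_differential fun D hD => ?_
      rw [Point.conormalOf, Submodule.mem_dualAnnihilator] at hc
      refine hc D fun a ha => ?_
      obtain ⟨h₁, h₂, h₃⟩ := D.2
      have h0 : D.1 0 = 0 := by
        have := h₁ 0 0
        simpa using this
      suffices h : x.ev a = 0 ∧ D.1 a = 0 from h.2
      rw [Point.vanishingIdeal] at ha
      induction ha using Submodule.span_induction with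
      | mem a ha =>
        refine ⟨?_, hD a ha⟩
        obtain ⟨U, hU, s, rfl, hs⟩ := ha
        exact hs x hx hU
      | zero => exact ⟨map_zero _, h0⟩
      | add a b _ _ ha hb =>
        refine ⟨?_, ?_⟩
        · rw [map_add, ha.1, hb.1, add_zero]
        · rw [h₁, ha.2, hb.2, add_zero]
      | smul t a _ ha =>
        refine ⟨?_, ?_⟩
        · rw [smul_eq_mul, map_mul, ha.1, mul_zero]
        · rw [smul_eq_mul, h₂, ha.1, ha.2, mul_zero, zero_mul, add_zero]
    suffices h : ∀ (r : AlgebraicClosure F) (y : x.cotangent),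
        (⟨x, y⟩ : Cotangent f (AlgebraicClosure F)) ∈ singularSupport κ ξ →
          (⟨x, y + r • c⟩ : Cotangent f (AlgebraicClosure F)) ∈ singularSupport κ ξ by
      simpa using h 1 y hy
    clear hc
    induction hspan using Submodule.span_induction with
    | mem c hc =>
      obtain ⟨a, ⟨U, hU, s, rfl, hs⟩, rfl⟩ := hc
      intro r y hy
      -- `s` vanishes on the support of `ξ`, which is contained in `W`.
      have hsξ : ∀ p ∈ support ξ, ∀ hp : p.pt ∈ U, p.value U hp s = 0 := by
        intro p hp hpU
        have h1 : p.extend (AlgebraicClosure F) ∈ W :=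
          ⟨⟨p.extend (AlgebraicClosure F), 0⟩, subset_zariskiClosure _
            ⟨⟨p, 0⟩, mk_zero_mem_algWaveFrontSet hκ hκ_ne hp, 0, by simp, rfl⟩, rfl⟩
        refine (algebraMap F (AlgebraicClosure F)).injective ?_
        rw [map_zero]
        exact hs _ h1 hpU
      exact zariskiClosure_add_smul_differential
        (fun z h v hv V hV φ => extendCotangent_add_smul_differential hκ hκ_ne hsξ h hv hV φ)
        hU hy r
    | zero => simp
    | add c c' _ _ h h' =>
      intro r y hy
      have := h' r _ (h r y hy)
      rwa [add_assoc, ← smul_add] at this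
    | smul t c _ h =>
      intro r y hy
      rw [smul_smul]
      exact h _ y hy
  -- Without local coordinates at `x` the equations of the closure are vacuous.
  · intro U _ n g hg P _ hxU
    exact absurd (finiteDimensional_cotangent (hg x hxU)) hfin

/-- The invariance under conormal shifts holds over every point of the projection, not only over the
smooth ones. -/
theorem isWeaklyCoisotropic_singularSupport [LocallyOfFiniteType f] (hκ : Continuous κ)
    (hκ_ne : κ ≠ 1) : IsWeaklyCoisotropic (singularSupport κ ξ) := by
  intro x hx y
  -- The intersection with `y + CN` is everything or empty.
  by_cases h : ∃ c : x.conormalOf (Sigma.fst '' singularSupport κ ξ),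
      (⟨x, y + c.1⟩ : Cotangent f (AlgebraicClosure F)) ∈ singularSupport κ ξ
  · obtain ⟨c₀, hc₀⟩ := h
    refine ⟨{1}, ?_⟩
    ext c
    have := singularSupport_add_conormalOf hκ hκ_ne hx.1 (c - c₀).2 hc₀
    rw [Submodule.coe_sub, add_add_sub_cancel] at this
    simpa using this
  · refine ⟨∅, ?_⟩
    ext c
    simpa using fun hc => h ⟨c, hc⟩

end WeaklyCoisotropic

end Microlocal

open Microlocal in
theorem mainTheorem1 {F : Type u} [NontriviallyNormedField F] [IsUltrametricDist F]
    [ProperSpace F] [CharZero F]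
    (κ : AddChar F Circle) (hκ : Continuous κ) (hκ_ne : κ ≠ 1) :
    -- analytic manifolds
    (∀ (n k : ℕ)
      (X : Type v) [TopologicalSpace X] [T2Space X] [ChartedSpace (Fin n → F) X]
      [IsManifold 𝓘(F, Fin n → F) ω X]
      (Y : Type v') [TopologicalSpace Y] [ChartedSpace (Fin k → F) Y]
      [IsManifold 𝓘(F, Fin k → F) ω Y]
      (i : Y → X) (_ : Manifold.IsSmoothEmbedding 𝓘(F, Fin k → F) 𝓘(F, Fin n → F) ω i)
      (E : LocallyConstantSheaf.{v, w} X) (ξ : E.Distribution) (_ : support ξ ⊆ Set.range i)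
      (y : Y) (v c : TangentSpace 𝓘(F, Fin n → F) (i y) →L[F] F)
      (_ : c.comp (mfderiv 𝓘(F, Fin k → F) 𝓘(F, Fin n → F) i y) = 0),
      (⟨i y, v⟩ : AnalyticCotangent F n X) ∈ waveFrontSet κ ξ →
        (⟨i y, v + c⟩ : AnalyticCotangent F n X) ∈ waveFrontSet κ ξ) ∧
    -- algebraic varieties
    (∀ (X Y : Scheme.{u}) (f : X ⟶ Spec (CommRingCat.of F))
      [Smooth f] [IsSeparated f] [QuasiCompact f]
      (i : Y ⟶ X) [IsImmersion i]
      (E : LocallyConstantSheaf.{u, w} (Point f F)) (ξ : E.Distribution)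
      (_ : support ξ ⊆ Set.range (Point.map (f := f) (K := F) i))
      (y : Point (i ≫ f) F) (_ : ∃ V : Y.Opens, y.pt ∈ V ∧ Smooth (V.ι ≫ i ≫ f))
      (v c : (y.map i).cotangent) (_ : c ∈ y.conormal i),
      (⟨y.map i, v⟩ : Cotangent f F) ∈ algWaveFrontSet κ ξ →
        (⟨y.map i, v + c⟩ : Cotangent f F) ∈ algWaveFrontSet κ ξ) ∧
    -- the singular support
    (∀ (X : Scheme.{u}) (f : X ⟶ Spec (CommRingCat.of F))
      [Smooth f] [IsSeparated f] [QuasiCompact f]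
      (E : LocallyConstantSheaf.{u, w} (Point f F)) (ξ : E.Distribution),
      IsWeaklyCoisotropic (singularSupport κ ξ)) := by
  refine ⟨?_, ?_, ?_⟩
  · intro n k X _ _ _ _ Y _ _ _ i hi E ξ hξ y v c hc hv
    obtain ⟨h, h0, hh, hd⟩ := exists_eq_zero_on_range hi y hc
    exact waveFrontSet_add_of_eq_zero_on_support hκ hκ_ne (h0.mono fun x hx hxs => hx (hξ hxs))
      hh hd hv
  · intro X Y f _ _ _ i _ E ξ hξ y _ v c hc hv
    exact algWaveFrontSet_add_conormal hκ hκ_ne i hξ y hc hv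
  · intro X f _ _ _ E ξ
    exact isWeaklyCoisotropic_singularSupport hκ hκ_ne
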